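/- For $d\in\mathbb N$ and $\sigma:\{\pm1\}^d\to[0,1]$, let $\mathsf{RAG}(n,\{\pm1\}^d,p,\sigma)$, where $p=\mathbf E_{\mathbf x\sim\mathsf{Unif}(\{\pm1\}^d)}[\sigma(\mathbf x)]$, be the random graph on $\{1,\dots,n\}$ obtained by drawing $\mathbf x_1,\dots,\mathbf x_n$ independently and uniformly from $\{\pm1\}^d$ and then, given these vectors, joining each pair $i<j$ independently with probability $\sigma(\mathbf x_i\mathbf x_j^{-1})$, the product being coordinatewise. Let $\mathsf G(n,p)$ be the random graph on $\{1,\dots,n\}$ in which each pair is joined independently with probability $p$. When $\delta_p$ is an integer with $\mathbf P_{\mathbf x\sim\mathsf{Unif}(\{\pm1\}^d)}\big[|\sum_{i=1}^d x_i|\ge\delta_p\big]=p$, let $\mathbf D_p(\mathbf x)=\mathbf 1\big[|\sum_{i=1}^d x_i|\ge\delta_p\big]$ be the double threshold connection. There is an absolute constant $K>0$ with the following property. Let $d=d(n)\in\mathbb N$, $p=p(n)\in[0,1]$ and $\delta_p=\delta_p(n)\in\mathbb Z$ be sequences such that, for all large $n$, $\mathbf P_{\mathbf x\sim\mathsf{Unif}(\{\pm1\}^d)}\big[|\sum_{i=1}^d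 x_i|\ge\delta_p\big]=p$. Suppose that, as $n\to\infty$, * $d$ is even and $d\ge K\,n\log n$ for all large $n$; * $d=\omega\big(n^{3/2}\,p\,\log^2\tfrac1p\big)$, that is, $n^{3/2}\,p\,\log^2\tfrac1p=o(d)$; * $1/p$ is polynomially bounded in $d$: there is a constant $C$ with $p\ge d^{-C}$ for all large $n$; * $p$ is bounded away from $1$: there is a constant $\varepsilon>0$ with $p\le1-\varepsilon$ for all large $n$. Then $$\mathsf{KL}\Big(\mathsf{RAG}(n,\{\pm1\}^d,p,\mathbf D_p)\,\Big\|\,\mathsf G(n,p)\Big)\longrightarrow 0\qquad(n\to\infty).$$ -/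

import Mathlib

open Filter MeasureTheory Topology
open scoped BigOperators

/-- The Boolean hypercube `{±1}^d` as a group under coordinatewise multiplication. -/
abbrev Hypercube (d : ℕ) : Type := Fin d → ℤˣ

open Classical in
/-- The conditional probability of the graph `A` on `n` vertices given the latent vectors `x`: each
pair `i < j` is an edge, independently, with probability `σ (x i * (x j)⁻¹)`. -/
noncomputable def condGraphProb {n : ℕ} {Γ : Type*} [CommGroup Γ] (σ : Γ → unitInterval)
    (x : Fin n → Γ) (A : SimpleGraph (Fin n)) : ℝ :=
  ∏ e : Fin n × Fin n with e.1 < e.2,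
    if A.Adj e.1 e.2 then (σ (x e.1 * (x e.2)⁻¹) : ℝ) else 1 - (σ (x e.1 * (x e.2)⁻¹) : ℝ)

/-- The law of the random algebraic graph on `n` vertices over a finite abelian group `Γ` with
connection `σ`: the latent vectors are independent and uniform on `Γ`, so that the graph `A` has
mass `𝔼 x, condGraphProb σ x A`, the average over all `x : Fin n → Γ`. -/
noncomputable def randomAlgebraicGraph (n : ℕ) (Γ : Type*) [CommGroup Γ] [Fintype Γ]
    (σ : Γ → unitInterval) :
    Measure (SimpleGraph (Fin n)) :=
  Measure.sum fun A : SimpleGraph (Fin n) =>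
    ENNReal.ofReal (𝔼 x : Fin n → Γ, condGraphProb σ x A) • Measure.dirac A

/-- The double threshold connection `x ↦ 𝟙[|∑ i, x i| ≥ δ]` on the hypercube. -/
def doubleThreshold (d : ℕ) (δ : ℤ) (x : Hypercube d) : unitInterval :=
  if δ ≤ |∑ i, (x i : ℤ)| then 1 else 0

/-- The probability that `|∑ i, x i| ≥ δ` when `x` is uniform on the hypercube `{±1}^d`. -/
noncomputable def doubleThresholdProb (d : ℕ) (δ : ℤ) : ℝ :=
  ((Finset.univ.filter fun x : Hypercube d => δ ≤ |∑ i, (x i : ℤ)|).card : ℝ) / 2 ^ d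

/-! Reveal the graph one vertex at a time. By the chain rule the divergence is a sum of conditional
divergences, and each is at most the logarithm of a `χ²`-type quantity in which the earlier latent
vectors count as revealed. With two independent copies of the new vector this quantity factors over
the earlier vertices and becomes `𝔼 y, (1 + v y) ^ k`, where `v` is the autocorrelation of the
connection divided by `p (1 - p)` (`relEntropy_randomAlgebraicGraph_le`). Since `v` has mean zero,
only its second-order exponential moment matters.

Write `s` for the coordinate sum of `y`, `u = |s| / d` and `L = 1 + log (1 / p)`. The
autocorrelation is diagonal in the Walsh basis, and by symmetry it is a sum over levels `m` of
weight times normalized Krawtchouk function. The claim is `|v| ≲ p L² (u² + 1 / d) exp (2 ^ 10 u L)`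
for small `u` (`abs_autocorr_threshold_le`): - odd levels vanish, as the connection is even; - at a
level `2 j ≥ 2` with `j ≤ d / 2 ^ 24`, a Krawtchouk bound from the three-term recurrence and a
moment estimate on a set of measure `p` bound the weight by about `p² (64 (L + 2 j)) ^ (2 j) / (2
j)!`, against a Krawtchouk value of about `(16 u² + 8 j / d) ^ j`; - level `d - 2 j` mirrors level
`2 j`, because complementing an index set multiplies a Walsh character by the full character, of
modulus one; - the top level gains nothing from `y`, so its weight must itself be small: the full
coefficient is controlled by the boundary of the threshold set, giving `p² L² / d`
(`levelWeight_top_le`); - middle levels are exponentially small.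

Since `s² / d` has an exponential moment, this bounds the second-order term by about `(n p L² /
d)²`, up to `n² exp (-n)` from atypical `y` (`sq_mul_exp_le`). Summing over `n` vertices gives `n³
p² L⁴ / d²`, the square of `n ^ (3 / 2) p L² / d`, which tends to zero. -/

/-! ### Relative entropy of mixtures -/

/-- The relative entropy of two weight functions on a finite type, as a real number. -/
noncomputable def relEntropy {A : Type*} [Fintype A] (P Q : A → ℝ) : ℝ :=
  ∑ a, P a * Real.log (P a / Q a)

theorem sq_expect_mul_le {X : Type*} [Fintype X] (u v : X → ℝ) (hu : ∀ x, 0 ≤ u x) :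
    (𝔼 x, u x * v x) ^ 2 ≤ (𝔼 x, u x) * 𝔼 x, u x * v x ^ 2 := by
  have h := Finset.expect_mul_sq_le_sq_mul_sq Finset.univ (fun x => √(u x))
    (fun x => √(u x) * v x)
  have e1 : ∀ x, √(u x) * (√(u x) * v x) = u x * v x := fun x => by
    rw [← mul_assoc, Real.mul_self_sqrt (hu x)]
  have e2 : ∀ x, √(u x) ^ 2 = u x := fun x => Real.sq_sqrt (hu x)
  simpa only [e1, e2, mul_pow] using h

/-- The tangent line to `log` at `t`; choosing `t` to be the mean of `y` yields Jensen's inequality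
term by term. -/
theorem log_le_div_sub_one_add_log {y t : ℝ} (hy : 0 < y) (ht : 0 < t) :
    Real.log y ≤ y / t - 1 + Real.log t := by
  have := Real.log_le_sub_one_of_pos (div_pos hy ht)
  rw [Real.log_div hy.ne' ht.ne'] at this
  linarith

/-- Chain rule for the relative entropy of a mixture over a latent variable `x`, given which the
components `a` and `b` are independent, with the second term bounded by a `χ²`-divergence. -/
theorem relEntropy_mixture_le {X A B : Type*} [Fintype X] [Nonempty X] [Fintype A] [Fintype B]
    (P : X → A → ℝ) (R : X → B → ℝ) (Q₁ : A → ℝ) (Q₂ : B → ℝ)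
    (hP : ∀ x a, 0 ≤ P x a) (hR : ∀ x b, 0 ≤ R x b)
    (hP1 : ∀ x, ∑ a, P x a = 1) (hR1 : ∀ x, ∑ b, R x b = 1)
    (hQ₁ : ∀ a, 0 < Q₁ a) (hQ₂ : ∀ b, 0 < Q₂ b) :
    relEntropy (fun ab : A × B => 𝔼 x, P x ab.1 * R x ab.2) (fun ab => Q₁ ab.1 * Q₂ ab.2) ≤
      relEntropy (fun a => 𝔼 x, P x a) Q₁ + Real.log (𝔼 x, ∑ b, R x b ^ 2 / Q₂ b) := by
  set T : ℝ := 𝔼 x, ∑ b, R x b ^ 2 / Q₂ b with hT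
  have hTpos : 0 < T := by
    refine Finset.expect_pos (fun x _ => ?_) Finset.univ_nonempty
    have hne : ∃ b, R x b ≠ 0 := by
      by_contra! h
      have := hR1 x
      simp [h] at this
    obtain ⟨b, hb⟩ := hne
    exact Finset.sum_pos' (fun b _ => div_nonneg (sq_nonneg _) (hQ₂ b).le)
      ⟨b, Finset.mem_univ _, div_pos (by positivity) (hQ₂ b)⟩
  set PA : A → ℝ := fun a => 𝔼 x, P x a with hPA
  set J : A → B → ℝ := fun a b => 𝔼 x, P x a * R x b with hJ
  have hPA0 : ∀ a, 0 ≤ PA a := fun a => Finset.expect_nonneg fun x _ => hP x a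
  have hJ0 : ∀ a b, 0 ≤ J a b := fun a b =>
    Finset.expect_nonneg fun x _ => mul_nonneg (hP x a) (hR x b)
  have hJA : ∀ a, ∑ b, J a b = PA a := fun a => by
    simp only [hJ, hPA]
    rw [← Finset.expect_sum_comm]
    simp_rw [← Finset.mul_sum, hR1, mul_one]
  have hPA1 : ∑ a, PA a = 1 := by
    simp only [hPA]
    rw [← Finset.expect_sum_comm]
    simp_rw [hP1]
    exact Fintype.expect_const 1
  have hJle : ∀ a b, PA a = 0 → J a b = 0 := fun a b h => by
    have h1 : ∑ b, J a b = 0 := by rw [hJA, h]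
    exact (Finset.sum_eq_zero_iff_of_nonneg fun b _ => hJ0 a b).1 h1 b (Finset.mem_univ _)
  -- Cauchy–Schwarz for the conditional law of `x` given `a`. Summing over `a` then forgets this
  -- conditioning, which is why `T` involves only the uniform law of `x`.
  have hCS : ∀ a b, J a b ^ 2 / (PA a * Q₂ b) ≤ 𝔼 x, P x a * (R x b ^ 2 / Q₂ b) := by
    intro a b
    rcases (hPA0 a).eq_or_lt with h | h
    · rw [hJle a b h.symm]
      simp only [ne_eq, OfNat.ofNat_ne_zero, not_false_eq_true, zero_pow, zero_div]
      exact Finset.expect_nonneg fun x _ =>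
        mul_nonneg (hP x a) (div_nonneg (sq_nonneg _) (hQ₂ b).le)
    · have h1 := sq_expect_mul_le (fun x => P x a) (fun x => R x b) (fun x => hP x a)
      rw [div_le_iff₀ (mul_pos h (hQ₂ b))]
      have : (𝔼 x, P x a * (R x b ^ 2 / Q₂ b)) * (PA a * Q₂ b) =
          PA a * 𝔼 x, P x a * R x b ^ 2 := by
        simp_rw [← mul_div_assoc]
        rw [← Finset.expect_div]
        field_simp [(hQ₂ b).ne']
      rw [this]
      exact h1
  have hsum : ∑ a, ∑ b, J a b ^ 2 / (PA a * Q₂ b) ≤ T := by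
    calc _ ≤ ∑ a, ∑ b, 𝔼 x, P x a * (R x b ^ 2 / Q₂ b) :=
          Finset.sum_le_sum fun a _ => Finset.sum_le_sum fun b _ => hCS a b
      _ = T := by
          simp_rw [← Finset.expect_sum_comm, ← Finset.mul_sum]
          simp_rw [← Finset.sum_mul, hP1, one_mul]
          rfl
  -- The logarithm splits into the marginal part and the conditional part; the latter is replaced by
  -- its tangent at `T`, so that after summation the linear terms cancel and `log T` remains.
  have hterm : ∀ a b, J a b * Real.log (J a b / (Q₁ a * Q₂ b)) ≤
      J a b * Real.log (PA a / Q₁ a) +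
        (J a b ^ 2 / (PA a * Q₂ b) / T - J a b + J a b * Real.log T) := by
    intro a b
    rcases (hJ0 a b).eq_or_lt with h | h
    · rw [← h]; simp
    · have hPApos : 0 < PA a := lt_of_le_of_ne (hPA0 a) fun h0 => h.ne' (hJle a b h0.symm)
      have hq1 := hQ₁ a
      have hq2 := hQ₂ b
      have e : J a b / (Q₁ a * Q₂ b) = (PA a / Q₁ a) * (J a b / (PA a * Q₂ b)) := by
        field_simp
      rw [e, Real.log_mul (by positivity) (by positivity), mul_add]
      have hy : 0 < J a b / (PA a * Q₂ b) := by positivity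
      have := mul_le_mul_of_nonneg_left (log_le_div_sub_one_add_log hy hTpos) h.le
      have e3 : J a b * (J a b / (PA a * Q₂ b) / T - 1 + Real.log T) =
        J a b ^ 2 / (PA a * Q₂ b) / T - J a b + J a b * Real.log T := by ring
      linarith
  calc relEntropy (fun ab : A × B => J ab.1 ab.2) (fun ab => Q₁ ab.1 * Q₂ ab.2)
      = ∑ a, ∑ b, J a b * Real.log (J a b / (Q₁ a * Q₂ b)) := by
        rw [relEntropy, Fintype.sum_prod_type]
    _ ≤ ∑ a, ∑ b, (J a b * Real.log (PA a / Q₁ a) +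
        (J a b ^ 2 / (PA a * Q₂ b) / T - J a b + J a b * Real.log T)) :=
        Finset.sum_le_sum fun a _ => Finset.sum_le_sum fun b _ => hterm a b
    _ = relEntropy PA Q₁ + ((∑ a, ∑ b, J a b ^ 2 / (PA a * Q₂ b)) / T - 1 + Real.log T) := by
        simp_rw [Finset.sum_add_distrib, Finset.sum_sub_distrib, ← Finset.sum_mul, hJA,
          ← Finset.sum_div, hPA1, one_mul, relEntropy]
    _ ≤ _ := by
        have : (∑ a, ∑ b, J a b ^ 2 / (PA a * Q₂ b)) / T ≤ 1 := by
          rw [div_le_one hTpos]; exact hsum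
        linarith

/-! ### From measures on graphs to finite sums -/

instance measurableSingletonClass_simpleGraph_fin (n : ℕ) :
    MeasurableSingletonClass (SimpleGraph (Fin n)) where
  measurableSet_singleton G := by
    rw [← SimpleGraph.measurableEmbedding_edgeSet.measurableSet_image, Set.image_singleton]
    exact measurableSet_singleton _

theorem klDiv_eq_ofReal_relEntropy {Ω : Type*} [Fintype Ω] [MeasurableSpace Ω]
    [MeasurableSingletonClass Ω] (μ ν : Measure Ω) (P Q : Ω → ℝ)
    (hP : ∀ a, 0 ≤ P a) (hQ : ∀ a, 0 < Q a) (hP1 : ∑ a, P a = 1) (hQ1 : ∑ a, Q a = 1)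
    (hμ : ∀ a, μ {a} = ENNReal.ofReal (P a)) (hν : ∀ a, ν {a} = ENNReal.ofReal (Q a)) :
    InformationTheory.klDiv μ ν = ENNReal.ofReal (relEntropy P Q) := by
  have univ_eq : ∀ (m : Measure Ω) (W : Ω → ℝ), (∀ a, 0 ≤ W a) → ∑ a, W a = 1 →
      (∀ a, m {a} = ENNReal.ofReal (W a)) → m Set.univ = 1 := by
    intro m W hW hW1 hm
    have h := sum_measure_singleton (μ := m) (s := Finset.univ)
    rw [Finset.coe_univ] at h
    rw [← h]
    simp_rw [hm]
    rw [← ENNReal.ofReal_sum_of_nonneg fun a _ => hW a, hW1, ENNReal.ofReal_one]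
  have hμ1 : IsProbabilityMeasure μ := ⟨univ_eq μ P hP hP1 hμ⟩
  have hν1 : IsProbabilityMeasure ν := ⟨univ_eq ν Q (fun a => (hQ a).le) hQ1 hν⟩
  have hdens : μ = ν.withDensity fun a => ENNReal.ofReal (P a / Q a) := by
    refine Measure.ext_of_singleton fun a => ?_
    rw [withDensity_apply _ (measurableSet_singleton a), lintegral_singleton, hμ, hν,
      ← ENNReal.ofReal_mul (div_nonneg (hP a) (hQ a).le), div_mul_cancel₀ _ (hQ a).ne']
  have hac : μ ≪ ν := by rw [hdens]; exact withDensity_absolutelyContinuous _ _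
  have hrn : ∀ a, μ.rnDeriv ν a = ENNReal.ofReal (P a / Q a) := by
    have h : μ.rnDeriv ν =ᵐ[ν] fun a => ENNReal.ofReal (P a / Q a) := by
      rw [hdens]
      exact Measure.rnDeriv_withDensity ν (measurable_of_countable _)
    -- The density is determined only almost everywhere, but `ν` charges every point.
    intro a
    by_contra hne
    have h0 : ν {a} = 0 := measure_mono_null (Set.singleton_subset_iff.2 hne) h
    rw [hν, ENNReal.ofReal_eq_zero] at h0
    exact absurd (hQ a) (not_lt.2 h0)
  rw [InformationTheory.klDiv_of_ac_of_integrable hac Integrable.of_finite]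
  have hint : ∫ x, llr μ ν x ∂μ = relEntropy P Q := by
    rw [integral_fintype Integrable.of_finite, relEntropy]
    refine Finset.sum_congr rfl fun a _ => ?_
    rw [measureReal_def, hμ, ENNReal.toReal_ofReal (hP a), smul_eq_mul, llr, hrn,
      ENNReal.toReal_ofReal (div_nonneg (hP a) (hQ a).le)]
  rw [hint]
  simp

open Classical in
/-- The probability of the graph `A` when each pair is an edge independently with probability `p`. -/
noncomputable def bernoulliGraphProb {n : ℕ} (p : ℝ) (A : SimpleGraph (Fin n)) : ℝ :=
  ∏ e : Fin n × Fin n with e.1 < e.2, if A.Adj e.1 e.2 then p else 1 - p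

open Classical in
theorem card_filter_lt_adj {n : ℕ} (A : SimpleGraph (Fin n)) :
    (Finset.univ.filter fun e : Fin n × Fin n => e.1 < e.2 ∧ A.Adj e.1 e.2).card =
      A.edgeSet.ncard := by
  rw [← SimpleGraph.coe_edgeFinset, Set.ncard_coe_finset]
  refine Finset.card_bij (fun e _ => s(e.1, e.2)) ?_ ?_ ?_
  · intro e he
    simpa using (Finset.mem_filter.1 he).2.2
  · rintro ⟨a, b⟩ h1 ⟨a', b'⟩ h2 h
    simp only [Finset.mem_filter, Finset.mem_univ, true_and] at h1 h2
    simp only [Sym2.eq_iff] at h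
    rcases h with ⟨rfl, rfl⟩ | ⟨rfl, rfl⟩
    · rfl
    · exact absurd h1.1 (not_lt.2 h2.1.le)
  · intro e
    induction e with
    | _ a b =>
      intro h
      have hab : A.Adj a b := by simpa using h
      rcases lt_or_gt_of_ne hab.ne with hlt | hlt
      · exact ⟨(a, b), by simp [hlt, hab], rfl⟩
      · exact ⟨(b, a), by simp [hlt, hab.symm], Sym2.eq_swap⟩

open Classical in
theorem card_filter_lt (n : ℕ) :
    (Finset.univ.filter fun e : Fin n × Fin n => e.1 < e.2).card = n.choose 2 := by
  have h := card_filter_lt_adj (⊤ : SimpleGraph (Fin n))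
  rw [← SimpleGraph.coe_edgeFinset, Set.ncard_coe_finset,
    SimpleGraph.card_edgeFinset_top_eq_card_choose_two, Fintype.card_fin] at h
  rw [← h]
  congr 1
  ext e
  simp only [Finset.mem_filter, Finset.mem_univ, true_and, SimpleGraph.top_adj]
  exact ⟨fun h => ⟨h, h.ne⟩, fun h => h.1⟩

theorem bernoulliGraphProb_eq {n : ℕ} (p : ℝ) (A : SimpleGraph (Fin n)) :
    bernoulliGraphProb p A =
      p ^ A.edgeSet.ncard * (1 - p) ^ (n.choose 2 - A.edgeSet.ncard) := by
  classical
  rw [bernoulliGraphProb, Finset.prod_ite, Finset.prod_const, Finset.prod_const,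
    Finset.filter_filter, Finset.filter_filter]
  have h1 := card_filter_lt_adj A
  have h2 := card_filter_lt n
  have h3 : (Finset.univ.filter fun e : Fin n × Fin n => e.1 < e.2 ∧ A.Adj e.1 e.2).card +
      (Finset.univ.filter fun e : Fin n × Fin n => e.1 < e.2 ∧ ¬ A.Adj e.1 e.2).card =
      (Finset.univ.filter fun e : Fin n × Fin n => e.1 < e.2).card := by
    rw [← Finset.filter_filter, ← Finset.filter_filter]
    exact Finset.card_filter_add_card_filter_not _
  rw [h1, h2] at h3
  congr 2
  omega

theorem binomialRandom_singleton_eq {n : ℕ} (p : unitInterval) (A : SimpleGraph (Fin n)) :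
    SimpleGraph.binomialRandom (Fin n) p {A} = ENNReal.ofReal (bernoulliGraphProb (p : ℝ) A) := by
  have hp := p.2
  rw [SimpleGraph.binomialRandom_singleton, bernoulliGraphProb_eq, Nat.card_eq_fintype_card,
    Fintype.card_fin, ENNReal.ofReal_mul (pow_nonneg hp.1 _),
    ENNReal.ofReal_pow hp.1, ENNReal.ofReal_pow (sub_nonneg.2 hp.2)]
  congr 2
  · rw [ENNReal.ofReal]
    congr 1
    exact (Real.toNNReal_of_nonneg hp.1).symm ▸ rfl
  · rw [ENNReal.ofReal]
    congr 1
    exact (Real.toNNReal_of_nonneg (sub_nonneg.2 hp.2)).symm ▸ rfl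

theorem randomAlgebraicGraph_singleton (n : ℕ) (Γ : Type*) [CommGroup Γ] [Fintype Γ]
    (σ : Γ → unitInterval) (A : SimpleGraph (Fin n)) :
    randomAlgebraicGraph n Γ σ {A} = ENNReal.ofReal (𝔼 x : Fin n → Γ, condGraphProb σ x A) := by
  rw [randomAlgebraicGraph, Measure.sum_apply _ (measurableSet_singleton A), tsum_eq_single A]
  · simp
  · intro B hB
    simp [hB]

/-! ### Adding one vertex -/

/-- A graph on `n + 1` vertices is a graph on the first `n` vertices with the set of neighbours of
the last vertex. -/
noncomputable def graphSnocEquiv (n : ℕ) :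
    SimpleGraph (Fin n) × (Fin n → Bool) ≃ SimpleGraph (Fin (n + 1)) where
  toFun Ab :=
    { Adj := Fin.lastCases (motive := fun _ => Fin (n + 1) → Prop)
        (Fin.lastCases (motive := fun _ => Prop) False fun j => Ab.2 j = true)
        fun i => Fin.lastCases (motive := fun _ => Prop) (Ab.2 i = true) fun j => Ab.1.Adj i j
      symm := ⟨fun i j => by
        induction i using Fin.lastCases <;> induction j using Fin.lastCases <;>
          simp [SimpleGraph.adj_comm]⟩
      loopless := ⟨fun i => by induction i using Fin.lastCases <;> simp⟩ }
  invFun G := by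
    classical
    exact (G.comap Fin.castSucc, fun i => decide (G.Adj i.castSucc (Fin.last n)))
  left_inv Ab := by
    refine Prod.ext ?_ ?_
    · ext i j
      simp
    · funext i
      simp
  right_inv G := by
    ext i j
    induction i using Fin.lastCases <;> induction j using Fin.lastCases <;>
      simp [SimpleGraph.adj_comm]

theorem graphSnocEquiv_adj_castSucc {n : ℕ} (A : SimpleGraph (Fin n)) (b : Fin n → Bool)
    (i j : Fin n) : (graphSnocEquiv n (A, b)).Adj i.castSucc j.castSucc ↔ A.Adj i j := by
  simp [graphSnocEquiv]

theorem graphSnocEquiv_adj_last {n : ℕ} (A : SimpleGraph (Fin n)) (b : Fin n → Bool)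
    (i : Fin n) : (graphSnocEquiv n (A, b)).Adj i.castSucc (Fin.last n) ↔ b i = true := by
  simp [graphSnocEquiv]

open Classical in
theorem prod_pairs_succ {n : ℕ} (F : Fin (n + 1) → Fin (n + 1) → ℝ) :
    ∏ e : Fin (n + 1) × Fin (n + 1) with e.1 < e.2, F e.1 e.2 =
      (∏ e : Fin n × Fin n with e.1 < e.2, F e.1.castSucc e.2.castSucc) *
        ∏ i : Fin n, F i.castSucc (Fin.last n) := by
  have hl : ∀ i : Fin n, ¬ Fin.last n < i.castSucc := fun i => (Fin.le_last _).not_gt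
  simp only [Finset.prod_filter, Fintype.prod_prod_type, Fin.prod_univ_castSucc,
    Fin.castSucc_lt_castSucc_iff, Fin.castSucc_lt_last, if_true, lt_irrefl, if_false, hl,
    Finset.prod_const_one, mul_one, Finset.prod_mul_distrib]

/-- The probability `t` or `1 - t` of an edge indicator. -/
def bernoulliMass (t : ℝ) (b : Bool) : ℝ := if b then t else 1 - t

theorem condGraphProb_snoc {n : ℕ} {Γ : Type*} [CommGroup Γ] (σ : Γ → unitInterval)
    (x : Fin n → Γ) (z : Γ) (A : SimpleGraph (Fin n)) (b : Fin n → Bool) :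
    condGraphProb σ (Fin.snoc x z : Fin (n + 1) → Γ) (graphSnocEquiv n (A, b)) =
      condGraphProb σ x A * ∏ i, bernoulliMass (σ (x i * z⁻¹)) (b i) := by
  classical
  rw [condGraphProb, condGraphProb]
  have := prod_pairs_succ (n := n) fun i j =>
    if (graphSnocEquiv n (A, b)).Adj i j then
      (σ ((Fin.snoc x z : Fin (n + 1) → Γ) i * ((Fin.snoc x z : Fin (n + 1) → Γ) j)⁻¹) : ℝ)
    else 1 - (σ ((Fin.snoc x z : Fin (n + 1) → Γ) i * ((Fin.snoc x z : Fin (n + 1) → Γ) j)⁻¹) : ℝ)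
  simp only [graphSnocEquiv_adj_castSucc, graphSnocEquiv_adj_last, Fin.snoc_castSucc,
    Fin.snoc_last] at this
  simp only [bernoulliMass]
  convert this

theorem bernoulliGraphProb_snoc {n : ℕ} (p : ℝ) (A : SimpleGraph (Fin n)) (b : Fin n → Bool) :
    bernoulliGraphProb p (graphSnocEquiv n (A, b)) =
      bernoulliGraphProb p A * ∏ i, bernoulliMass p (b i) := by
  classical
  rw [bernoulliGraphProb, bernoulliGraphProb]
  have := prod_pairs_succ (n := n) fun i j => if (graphSnocEquiv n (A, b)).Adj i j then p else 1 - p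
  simp only [graphSnocEquiv_adj_castSucc, graphSnocEquiv_adj_last] at this
  simp only [bernoulliMass]
  convert this

theorem sum_prod_bool {n : ℕ} (F : Fin n → Bool → ℝ) :
    ∑ b : Fin n → Bool, ∏ i, F i (b i) = ∏ i, (F i true + F i false) := by
  have := Finset.prod_univ_sum (fun _ : Fin n => (Finset.univ : Finset Bool)) F
  simp only [Fintype.univ_bool] at this
  rw [show ∏ i, (F i true + F i false) = ∏ i, ∑ j ∈ ({true, false} : Finset Bool), F i j by simp]
  rw [this]
  rw [show (Fintype.piFinset fun _ : Fin n => ({true, false} : Finset Bool)) = Finset.univ by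
    ext; simp]

theorem bernoulliMass_nonneg {t : ℝ} (h0 : 0 ≤ t) (h1 : t ≤ 1) (b : Bool) :
    0 ≤ bernoulliMass t b := by
  unfold bernoulliMass; split_ifs <;> linarith

theorem bernoulliMass_pos {t : ℝ} (h0 : 0 < t) (h1 : t < 1) (b : Bool) :
    0 < bernoulliMass t b := by
  unfold bernoulliMass; split_ifs <;> linarith

theorem condGraphProb_nonneg {n : ℕ} {Γ : Type*} [CommGroup Γ] (σ : Γ → unitInterval)
    (x : Fin n → Γ) (A : SimpleGraph (Fin n)) : 0 ≤ condGraphProb σ x A := by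
  refine Finset.prod_nonneg fun e _ => ?_
  have := (σ (x e.1 * (x e.2)⁻¹)).2
  split_ifs
  · exact this.1
  · exact sub_nonneg.2 this.2

theorem bernoulliGraphProb_pos {n : ℕ} {p : ℝ} (h0 : 0 < p) (h1 : p < 1)
    (A : SimpleGraph (Fin n)) : 0 < bernoulliGraphProb p A := by
  refine Finset.prod_pos fun e _ => ?_
  split_ifs <;> linarith

theorem sum_condGraphProb {n : ℕ} {Γ : Type*} [CommGroup Γ] (σ : Γ → unitInterval)
    (x : Fin n → Γ) : ∑ A, condGraphProb σ x A = 1 := by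
  induction n with
  | zero =>
    have : ∀ A, condGraphProb σ x A = 1 := fun A => by
      rw [condGraphProb, Finset.prod_eq_one]
      rintro ⟨i, _⟩
      exact i.elim0
    simp_rw [this]
    simp
  | succ n ih =>
    rw [← (graphSnocEquiv n).sum_comp, Fintype.sum_prod_type]
    have hx : x = (Fin.snoc (fun i => x i.castSucc) (x (Fin.last n)) : Fin (n + 1) → Γ) :=
      (Fin.snoc_init_self x).symm
    rw [hx]
    simp_rw [condGraphProb_snoc, ← Finset.mul_sum]
    simp_rw [sum_prod_bool fun i b => bernoulliMass (σ (x i.castSucc * (x (Fin.last n))⁻¹)) b]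
    simp [bernoulliMass, ih]

theorem sum_bernoulliGraphProb (n : ℕ) (p : ℝ) :
    ∑ A : SimpleGraph (Fin n), bernoulliGraphProb p A = 1 := by
  induction n with
  | zero =>
    have : ∀ A : SimpleGraph (Fin 0), bernoulliGraphProb p A = 1 := fun A => by
      rw [bernoulliGraphProb, Finset.prod_eq_one]
      rintro ⟨i, _⟩
      exact i.elim0
    simp_rw [this]
    simp
  | succ n ih =>
    rw [← (graphSnocEquiv n).sum_comp, Fintype.sum_prod_type]
    simp_rw [bernoulliGraphProb_snoc, ← Finset.mul_sum]
    simp_rw [sum_prod_bool fun (_ : Fin n) b => bernoulliMass p b]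
    simp [bernoulliMass, ih]

theorem expect_snoc {n : ℕ} {Γ : Type*} [Fintype Γ] (F : (Fin (n + 1) → Γ) → ℝ) :
    𝔼 x, F x = 𝔼 x : Fin n → Γ, 𝔼 z, F (Fin.snoc x z) := by
  rw [← Finset.expect_product' Finset.univ Finset.univ
    (fun (x : Fin n → Γ) (z : Γ) => F (Fin.snoc x z))]
  symm
  exact Fintype.expect_equiv ((Equiv.prodComm _ _).trans (Fin.snocEquiv fun _ => Γ)) _ _
    fun x => rfl

theorem expect_prod_eq_pow {n : ℕ} {Γ : Type*} [Fintype Γ] [Nonempty Γ] (g : Γ → ℝ) :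
    𝔼 x : Fin n → Γ, ∏ i, g (x i) = (𝔼 z, g z) ^ n := by
  induction n with
  | zero => simp
  | succ n ih =>
    rw [expect_snoc]
    simp only [Fin.prod_univ_castSucc, Fin.snoc_castSucc, Fin.snoc_last]
    simp_rw [← Finset.mul_expect, ← Finset.expect_mul, ih]
    rw [pow_succ]

/-! ### The `χ²` quantity and the vertex-by-vertex bound -/

/-- The autocorrelation at `y` of the deviation of the connection from `p`. -/
noncomputable def autocorr {Γ : Type*} [CommGroup Γ] [Fintype Γ] (σ : Γ → unitInterval) (p : ℝ)
    (y : Γ) : ℝ :=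
  𝔼 z, ((σ z : ℝ) - p) * ((σ (y * z) : ℝ) - p)

/-- The `χ²`-type quantity of the neighbourhood of one vertex among `n` earlier ones. -/
theorem expect_sum_sq_div {n : ℕ} {Γ : Type*} [CommGroup Γ] [Fintype Γ] (σ : Γ → unitInterval)
    {p : ℝ} (h0 : 0 < p) (h1 : p < 1) :
    𝔼 x : Fin n → Γ, ∑ b : Fin n → Bool,
        (𝔼 z, ∏ i, bernoulliMass (σ (x i * z⁻¹)) (b i)) ^ 2 / ∏ i, bernoulliMass p (b i) =
      𝔼 y, (1 + autocorr σ p y / (p * (1 - p))) ^ n := by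
  have hpp : 0 < 1 - p := by linarith
  -- The square becomes an average over two independent copies `z`, `w` of the new latent vector, so
  -- that everything is a product over the earlier vertices.
  have e1 : ∀ (x : Fin n → Γ) (b : Fin n → Bool),
      (𝔼 z, ∏ i, bernoulliMass (σ (x i * z⁻¹)) (b i)) ^ 2 / ∏ i, bernoulliMass p (b i) =
      𝔼 z, 𝔼 w, ∏ i, bernoulliMass (σ (x i * z⁻¹)) (b i) * bernoulliMass (σ (x i * w⁻¹)) (b i) /
        bernoulliMass p (b i) := by
    intro x b
    rw [pow_two, Fintype.expect_mul_expect, Finset.expect_div]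
    refine Finset.expect_congr rfl fun z _ => ?_
    rw [Finset.expect_div]
    refine Finset.expect_congr rfl fun w _ => ?_
    rw [Finset.prod_div_distrib, Finset.prod_mul_distrib]
  simp_rw [e1]
  have e2 : ∀ x : Fin n → Γ,
      ∑ b : Fin n → Bool, 𝔼 z, 𝔼 w, ∏ i, bernoulliMass (σ (x i * z⁻¹)) (b i) *
        bernoulliMass (σ (x i * w⁻¹)) (b i) / bernoulliMass p (b i) =
      𝔼 z, 𝔼 w, ∏ i, (1 + ((σ (x i * z⁻¹) : ℝ) - p) * ((σ (x i * w⁻¹) : ℝ) - p) /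
        (p * (1 - p))) := by
    intro x
    rw [← Finset.expect_sum_comm]
    refine Finset.expect_congr rfl fun z _ => ?_
    rw [← Finset.expect_sum_comm]
    refine Finset.expect_congr rfl fun w _ => ?_
    rw [sum_prod_bool fun i b => bernoulliMass (σ (x i * z⁻¹)) b *
      bernoulliMass (σ (x i * w⁻¹)) b / bernoulliMass p b]
    -- For edge probabilities `a`, `b`: `a b / p + (1 - a) (1 - b) / (1 - p) = 1 + (a - p) (b - p) /
    -- (p (1 - p))`.
    refine Finset.prod_congr rfl fun i _ => ?_
    simp only [bernoulliMass, if_true, Bool.false_eq_true, if_false]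
    field_simp
    ring
  simp_rw [e2]
  rw [Finset.expect_comm]
  simp_rw [Finset.expect_comm (Finset.univ : Finset (Fin n → Γ))]
  have e3 : ∀ z w : Γ, 𝔼 x : Fin n → Γ, ∏ i, (1 + ((σ (x i * z⁻¹) : ℝ) - p) *
      ((σ (x i * w⁻¹) : ℝ) - p) / (p * (1 - p))) =
      (1 + autocorr σ p (z * w⁻¹) / (p * (1 - p))) ^ n := by
    intro z w
    rw [expect_prod_eq_pow fun u => 1 + ((σ (u * z⁻¹) : ℝ) - p) *
      ((σ (u * w⁻¹) : ℝ) - p) / (p * (1 - p))]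
    congr 1
    rw [Finset.expect_add_distrib, Fintype.expect_const, ← Finset.expect_div, autocorr]
    congr 2
    refine Fintype.expect_equiv (Equiv.mulRight z⁻¹) _ _ fun u => ?_
    simp only [Equiv.coe_mulRight]
    rw [show z * w⁻¹ * (u * z⁻¹) = u * w⁻¹ by
      rw [mul_comm u z⁻¹, mul_assoc, mul_comm w⁻¹, ← mul_assoc, ← mul_assoc, mul_inv_cancel,
        one_mul]]
  simp_rw [e3]
  have e4 : ∀ z : Γ, 𝔼 w, (1 + autocorr σ p (z * w⁻¹) / (p * (1 - p))) ^ n =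
      𝔼 y, (1 + autocorr σ p y / (p * (1 - p))) ^ n := fun z =>
    Fintype.expect_equiv ((Equiv.inv Γ).trans (Equiv.mulLeft z)) _ _ fun w => rfl
  simp_rw [e4]
  exact Fintype.expect_const _

/-- Vertex-by-vertex bound for the relative entropy of a random algebraic graph to the
binomial random graph. -/
theorem relEntropy_randomAlgebraicGraph_le (n : ℕ) {Γ : Type*} [CommGroup Γ] [Fintype Γ]
    (σ : Γ → unitInterval) {p : ℝ} (h0 : 0 < p) (h1 : p < 1) :
    relEntropy (fun A : SimpleGraph (Fin n) => 𝔼 x : Fin n → Γ, condGraphProb σ x A)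
        (bernoulliGraphProb p) ≤
      ∑ k ∈ Finset.range n, Real.log (𝔼 y, (1 + autocorr σ p y / (p * (1 - p))) ^ k) := by
  induction n with
  | zero =>
    have h : ∀ (x : Fin 0 → Γ) A, condGraphProb σ x A = 1 := fun x A => by
      rw [condGraphProb, Finset.prod_eq_one]
      rintro ⟨i, _⟩
      exact i.elim0
    have h' : ∀ A : SimpleGraph (Fin 0), bernoulliGraphProb p A = 1 := fun A => by
      rw [bernoulliGraphProb, Finset.prod_eq_one]
      rintro ⟨i, _⟩
      exact i.elim0
    simp [relEntropy, h, h']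
  | succ n ih =>
    rw [Finset.sum_range_succ]
    -- Given the earlier vectors `x`, the new vector is independent of the earlier graph, so
    -- averaging over it makes the old graph and the new neighbourhood independent components.
    have key := relEntropy_mixture_le (fun (x : Fin n → Γ) A => condGraphProb σ x A)
      (fun (x : Fin n → Γ) (b : Fin n → Bool) => 𝔼 z, ∏ i, bernoulliMass (σ (x i * z⁻¹)) (b i))
      (bernoulliGraphProb p) (fun b => ∏ i, bernoulliMass p (b i))
      (fun x A => condGraphProb_nonneg σ x A)
      (fun x b => Finset.expect_nonneg fun z _ => Finset.prod_nonneg fun i _ =>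
        bernoulliMass_nonneg (σ _).2.1 (σ _).2.2 _)
      (fun x => sum_condGraphProb σ x)
      (fun x => by
        rw [← Finset.expect_sum_comm]
        refine Eq.trans (Finset.expect_congr rfl fun z _ => ?_) (Fintype.expect_const (ι := Γ) 1)
        rw [sum_prod_bool fun i b => bernoulliMass (σ (x i * z⁻¹)) b]
        simp [bernoulliMass])
      (fun A => bernoulliGraphProb_pos h0 h1 A)
      (fun b => Finset.prod_pos fun i _ => bernoulliMass_pos h0 h1 _)
    rw [expect_sum_sq_div σ h0 h1] at key
    refine le_trans (le_of_eq ?_) (key.trans (add_le_add_left ih _))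
    rw [relEntropy, ← (graphSnocEquiv n).sum_comp, relEntropy]
    refine Finset.sum_congr rfl fun Ab _ => ?_
    obtain ⟨A, b⟩ := Ab
    simp only [bernoulliGraphProb_snoc, expect_snoc (Γ := Γ), condGraphProb_snoc,
      ← Finset.mul_expect]

/-! ### Walsh analysis on the hypercube -/

/-- The real coordinate `x i = ±1`. -/
def coordSign {d : ℕ} (x : Hypercube d) (i : Fin d) : ℝ := ((x i : ℤ) : ℝ)

/-- The real sum of the coordinates. -/
def signSum {d : ℕ} (x : Hypercube d) : ℝ := ∑ i, coordSign x i

/-- The character of the hypercube indexed by a set of coordinates. -/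
def walsh {d : ℕ} (S : Finset (Fin d)) (x : Hypercube d) : ℝ := ∏ i ∈ S, coordSign x i

theorem coordSign_eq_or {d : ℕ} (x : Hypercube d) (i : Fin d) :
    coordSign x i = 1 ∨ coordSign x i = -1 := by
  rcases Int.units_eq_one_or (x i) with h | h <;> simp [coordSign, h]

theorem coordSign_mul_self {d : ℕ} (x : Hypercube d) (i : Fin d) :
    coordSign x i * coordSign x i = 1 := by
  rcases coordSign_eq_or x i with h | h <;> simp [h]

theorem abs_coordSign {d : ℕ} (x : Hypercube d) (i : Fin d) : |coordSign x i| = 1 := by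
  rcases coordSign_eq_or x i with h | h <;> simp [h]

theorem coordSign_mul {d : ℕ} (x y : Hypercube d) (i : Fin d) :
    coordSign (x * y) i = coordSign x i * coordSign y i := by
  simp [coordSign]

theorem walsh_mul {d : ℕ} (S : Finset (Fin d)) (x y : Hypercube d) :
    walsh S (x * y) = walsh S x * walsh S y := by
  simp [walsh, coordSign_mul, Finset.prod_mul_distrib]

theorem abs_walsh {d : ℕ} (S : Finset (Fin d)) (x : Hypercube d) : |walsh S x| = 1 := by
  simp [walsh, Finset.abs_prod, abs_coordSign]

theorem walsh_mul_self {d : ℕ} (S : Finset (Fin d)) (x : Hypercube d) :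
    walsh S x * walsh S x = 1 := by
  rw [← abs_mul_abs_self, abs_walsh, one_mul]

theorem sum_walsh_mul_walsh {d : ℕ} (x y : Hypercube d) :
    ∑ S, walsh S x * walsh S y = if x = y then (2 : ℝ) ^ d else 0 := by
  have h : ∑ S, walsh S x * walsh S y = ∏ i, (1 + coordSign x i * coordSign y i) := by
    rw [Finset.prod_one_add, Finset.powerset_univ]
    simp [walsh, Finset.prod_mul_distrib]
  rw [h]
  split_ifs with hxy
  · subst hxy
    simp only [coordSign_mul_self]
    norm_num
  · obtain ⟨i, hi⟩ := Function.ne_iff.1 hxy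
    refine Finset.prod_eq_zero (Finset.mem_univ i) ?_
    rcases Int.units_eq_one_or (x i) with h1 | h1 <;>
      rcases Int.units_eq_one_or (y i) with h2 | h2 <;>
      simp_all [coordSign]

/-- The Walsh–Fourier coefficient. -/
noncomputable def walshCoeff {d : ℕ} (f : Hypercube d → ℝ) (S : Finset (Fin d)) : ℝ :=
  𝔼 x, f x * walsh S x

theorem card_hypercube (d : ℕ) : Fintype.card (Hypercube d) = 2 ^ d := by
  simp [Hypercube]

theorem eq_sum_walshCoeff {d : ℕ} (f : Hypercube d → ℝ) (y : Hypercube d) :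
    f y = ∑ S, walshCoeff f S * walsh S y := by
  simp only [walshCoeff, Finset.expect_mul]
  rw [← Finset.expect_sum_comm]
  simp_rw [mul_assoc, ← Finset.mul_sum, sum_walsh_mul_walsh]
  rw [Fintype.expect_eq_sum_div_card, card_hypercube]
  simp

/-- Characters are multiplicative, so translation acts diagonally on the Walsh expansion. -/
theorem expect_mul_translate {d : ℕ} (f : Hypercube d → ℝ) (x : Hypercube d) :
    𝔼 z, f z * f (x * z) = ∑ S, walshCoeff f S ^ 2 * walsh S x := by
  have h : ∀ z, f z * f (x * z) = ∑ S, walshCoeff f S * walsh S x * (f z * walsh S z) := by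
    intro z
    conv_lhs => rw [eq_sum_walshCoeff f (x * z)]
    rw [Finset.mul_sum]
    refine Finset.sum_congr rfl fun S _ => ?_
    rw [walsh_mul]; ring
  simp_rw [h]
  rw [Finset.expect_sum_comm]
  refine Finset.sum_congr rfl fun S _ => ?_
  rw [← Finset.mul_expect]
  change _ * walshCoeff f S = _
  ring

/-! ### Krawtchouk functions and symmetric functions -/

/-- The elementary symmetric polynomial of the coordinates. -/
noncomputable def levelSum {d : ℕ} (m : ℕ) (x : Hypercube d) : ℝ :=
  ∑ S ∈ Finset.powersetCard m Finset.univ, walsh S x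

/-- The normalized Krawtchouk function: the average of the characters of level `m`. -/
noncomputable def krawtchouk {d : ℕ} (m : ℕ) (x : Hypercube d) : ℝ :=
  levelSum m x / (d.choose m : ℝ)

-- Logarithmic derivative of the generating function: since `xᵢ² = 1`, each `xᵢ / (1 + xᵢ X)` equals
-- `(xᵢ - X) / (1 - X²)`. Comparing coefficients yields the three-term recurrence.
open Polynomial in
theorem derivative_prod_one_add {d : ℕ} (x : Hypercube d) (S : Finset (Fin d)) :
    (1 - X ^ 2) * derivative (∏ i ∈ S, (1 + C (coordSign x i) * X)) =
      (C (∑ i ∈ S, coordSign x i) - C (S.card : ℝ) * X) * ∏ i ∈ S, (1 + C (coordSign x i) * X) := by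
  classical
  induction S using Finset.induction_on with
  | empty => simp
  | insert a S ha ih =>
    rw [Finset.prod_insert ha, Finset.sum_insert ha, Finset.card_insert_of_notMem ha, derivative_mul,
      mul_add, mul_left_comm (1 - X ^ 2) (1 + C (coordSign x a) * X), ih]
    have h : (C (coordSign x a) * C (coordSign x a) : ℝ[X]) = 1 := by
      rw [← C_mul, coordSign_mul_self, C_1]
    simp only [derivative_add, derivative_one, derivative_mul, derivative_C, derivative_X, zero_mul,
      zero_add, mul_one, C_add, Nat.cast_add, Nat.cast_one, C_1]
    linear_combination (-X) * (∏ i ∈ S, (1 + C (coordSign x i) * X)) * h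

open Polynomial in
theorem coeff_prod_one_add {d : ℕ} (x : Hypercube d) (m : ℕ) :
    (∏ i, (1 + C (coordSign x i) * X)).coeff m = levelSum m x := by
  rw [Finset.prod_one_add, Finset.powerset_univ, finsetSum_coeff, levelSum]
  have h : ∀ S : Finset (Fin d), (∏ i ∈ S, C (coordSign x i) * X).coeff m =
      if S.card = m then walsh S x else 0 := by
    intro S
    rw [Finset.prod_mul_distrib, Finset.prod_const, ← map_prod, coeff_C_mul_X_pow]
    simp only [walsh, eq_comm]
  simp_rw [h]
  rw [← Finset.sum_filter]
  refine Finset.sum_congr ?_ fun _ _ => rfl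
  ext S
  simp [Finset.mem_powersetCard]

theorem levelSum_recurrence {d : ℕ} (x : Hypercube d) (m : ℕ) :
    ((m : ℝ) + 2) * levelSum (m + 2) x =
      signSum x * levelSum (m + 1) x - ((d : ℝ) - m) * levelSum m x := by
  open Polynomial in
  have h := congrArg (fun P : ℝ[X] => P.coeff (m + 1)) (derivative_prod_one_add x Finset.univ)
  simp only [sub_mul, one_mul, mul_assoc, Polynomial.coeff_sub, Polynomial.coeff_C_mul,
    Polynomial.coeff_X_mul, Polynomial.coeff_derivative, coeff_prod_one_add, Finset.card_univ,
    Fintype.card_fin] at h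
  have h2 : (Polynomial.X ^ 2 * Polynomial.derivative
      (∏ i, (1 + Polynomial.C (coordSign x i) * Polynomial.X))).coeff (m + 1) =
      m * levelSum m x := by
    rcases m with _ | m
    · rw [Polynomial.coeff_X_pow_mul']
      simp
    · rw [show m + 1 + 1 = m + 2 from rfl, Polynomial.coeff_X_pow_mul, Polynomial.coeff_derivative,
        coeff_prod_one_add]
      push_cast; ring
  rw [h2] at h
  rw [signSum]
  push_cast at h
  linarith

theorem levelSum_zero {d : ℕ} (x : Hypercube d) : levelSum 0 x = 1 := by
  simp [levelSum, walsh]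

theorem levelSum_one {d : ℕ} (x : Hypercube d) : levelSum 1 x = signSum x := by
  simp [levelSum, walsh, Finset.powersetCard_one, signSum]

theorem krawtchouk_zero {d : ℕ} (x : Hypercube d) : krawtchouk 0 x = 1 := by
  simp [krawtchouk, levelSum_zero]

theorem krawtchouk_one {d : ℕ} (x : Hypercube d) : krawtchouk 1 x = signSum x / d := by
  simp [krawtchouk, levelSum_one]

theorem choose_mul_krawtchouk {d m : ℕ} (hm : m ≤ d) (x : Hypercube d) :
    (d.choose m : ℝ) * krawtchouk m x = levelSum m x := by
  have : (d.choose m : ℝ) ≠ 0 := by exact_mod_cast (Nat.choose_pos hm).ne'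
  rw [krawtchouk, mul_div_cancel₀ _ this]

theorem krawtchouk_recurrence {d : ℕ} (x : Hypercube d) {m : ℕ} (hm : m + 2 ≤ d) :
    ((d : ℝ) - (m + 1)) * krawtchouk (m + 2) x =
      signSum x * krawtchouk (m + 1) x - (m + 1) * krawtchouk m x := by
  have h := levelSum_recurrence x m
  rw [← choose_mul_krawtchouk hm, ← choose_mul_krawtchouk (by omega : m + 1 ≤ d),
    ← choose_mul_krawtchouk (by omega : m ≤ d)] at h
  have c1 : (d.choose (m + 2) : ℝ) * (m + 2) = d.choose (m + 1) * ((d : ℝ) - (m + 1)) := by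
    have := Nat.choose_succ_right_eq d (m + 1)
    have h3 : ((d - (m + 1) : ℕ) : ℝ) = (d : ℝ) - (m + 1) := by
      rw [Nat.cast_sub (by omega)]; push_cast; ring
    rw [← h3]
    exact_mod_cast this
  have c2 : (d.choose (m + 1) : ℝ) * (m + 1) = d.choose m * ((d : ℝ) - m) := by
    have := Nat.choose_succ_right_eq d m
    have h3 : ((d - m : ℕ) : ℝ) = (d : ℝ) - m := by
      rw [Nat.cast_sub (by omega)]
    rw [← h3]
    exact_mod_cast this
  have c3 : (d.choose (m + 1) : ℝ) ≠ 0 := by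
    exact_mod_cast (Nat.choose_pos (by omega : m + 1 ≤ d)).ne'
  apply mul_left_cancel₀ c3
  linear_combination h - krawtchouk (m + 2) x * c1 + krawtchouk m x * c2

theorem abs_krawtchouk_le_one {d m : ℕ} (x : Hypercube d) : |krawtchouk m x| ≤ 1 := by
  rw [krawtchouk, abs_div, Nat.abs_cast]
  refine div_le_one_of_le₀ ?_ (Nat.cast_nonneg _)
  refine (Finset.abs_sum_le_sum_abs _ _).trans ?_
  simp [abs_walsh]

/-- The characters of `S` and of its complement multiply to the full character. This mirrors level
`m` to level `d - m` up to a sign. -/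
theorem levelSum_compl {d m : ℕ} (hm : m ≤ d) (x : Hypercube d) :
    levelSum (d - m) x = walsh Finset.univ x * levelSum m x := by
  classical
  rw [levelSum, levelSum, Finset.mul_sum]
  refine Finset.sum_nbij' (fun S => Sᶜ) (fun S => Sᶜ) ?_ ?_ ?_ ?_ ?_
  · intro S hS
    simp only [Finset.mem_powersetCard, Finset.subset_univ, true_and] at hS ⊢
    rw [Finset.card_compl, Fintype.card_fin, hS]; omega
  · intro S hS
    simp only [Finset.mem_powersetCard, Finset.subset_univ, true_and] at hS ⊢
    rw [Finset.card_compl, Fintype.card_fin, hS]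
  · simp
  · simp
  · intro S _
    have : walsh Finset.univ x = walsh S x * walsh Sᶜ x := (Finset.prod_mul_prod_compl S _).symm
    rw [this, mul_assoc, walsh_mul_self, mul_one]

theorem krawtchouk_compl {d m : ℕ} (hm : m ≤ d) (x : Hypercube d) :
    krawtchouk (d - m) x = walsh Finset.univ x * krawtchouk m x := by
  rw [krawtchouk, levelSum_compl hm, Nat.choose_symm hm, krawtchouk, mul_div_assoc]

theorem abs_krawtchouk_compl {d m : ℕ} (hm : m ≤ d) (x : Hypercube d) :
    |krawtchouk (d - m) x| = |krawtchouk m x| := by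
  rw [krawtchouk_compl hm, abs_mul, abs_walsh, one_mul]

theorem walshCoeff_eq_of_card_eq {d : ℕ} (f : Hypercube d → ℝ)
    (hf : ∀ (e : Equiv.Perm (Fin d)) x, f (x ∘ e) = f x) {S T : Finset (Fin d)}
    (hST : S.card = T.card) : walshCoeff f S = walshCoeff f T := by
  classical
  obtain ⟨e, he⟩ : ∃ e : Equiv.Perm (Fin d), S.map e.toEmbedding = T := by
    have e0 : {i // i ∈ S} ≃ {i // i ∈ T} := Fintype.equivOfCardEq (by simpa using hST)
    refine ⟨e0.extendSubtype, ?_⟩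
    refine Finset.eq_of_subset_of_card_le ?_ (by simp [hST])
    intro j hj
    obtain ⟨i, hi, rfl⟩ := Finset.mem_map.1 hj
    exact Equiv.extendSubtype_mem e0 i hi
  rw [walshCoeff, walshCoeff]
  refine (Fintype.expect_equiv (Equiv.arrowCongr e (Equiv.refl ℤˣ)) _ _ fun x => ?_)
  have h1 : (Equiv.arrowCongr e (Equiv.refl ℤˣ)) x = x ∘ e.symm := rfl
  rw [h1, hf, ← he, walsh, walsh, Finset.prod_map]
  congr 1
  refine Finset.prod_congr rfl fun i _ => ?_
  simp [coordSign]

/-- A permutation-invariant function has equal coefficients across a level, so each one equals their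
average. -/
theorem walshCoeff_eq_expect_krawtchouk {d : ℕ} (f : Hypercube d → ℝ)
    (hf : ∀ (e : Equiv.Perm (Fin d)) x, f (x ∘ e) = f x) (S : Finset (Fin d)) :
    walshCoeff f S = 𝔼 x, f x * krawtchouk S.card x := by
  have hS : S.card ≤ d := by simpa using Finset.card_le_univ S
  have h0 : (d.choose S.card : ℝ) ≠ 0 := by exact_mod_cast (Nat.choose_pos hS).ne'
  apply mul_left_cancel₀ h0
  rw [Finset.mul_expect]
  have h1 : ∀ x, (d.choose S.card : ℝ) * (f x * krawtchouk S.card x) =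
      ∑ T ∈ Finset.powersetCard S.card Finset.univ, f x * walsh T x := fun x => by
    rw [mul_left_comm, choose_mul_krawtchouk hS, levelSum, Finset.mul_sum]
  simp_rw [h1]
  rw [Finset.expect_sum_comm]
  have h2 : ∀ T ∈ Finset.powersetCard S.card (Finset.univ : Finset (Fin d)),
      𝔼 x, f x * walsh T x = walshCoeff f S := fun T hT =>
    walshCoeff_eq_of_card_eq f hf (Finset.mem_powersetCard.1 hT).2
  rw [Finset.sum_congr rfl h2]
  simp

/-- The weight at level `m` of a symmetric function. -/
noncomputable def levelWeight {d : ℕ} (f : Hypercube d → ℝ) (m : ℕ) : ℝ :=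
  (d.choose m : ℝ) * (𝔼 x, f x * krawtchouk m x) ^ 2

theorem levelWeight_nonneg {d : ℕ} (f : Hypercube d → ℝ) (m : ℕ) : 0 ≤ levelWeight f m := by
  unfold levelWeight; positivity

theorem expect_mul_translate_eq_sum_level {d : ℕ} (f : Hypercube d → ℝ)
    (hf : ∀ (e : Equiv.Perm (Fin d)) x, f (x ∘ e) = f x) (x : Hypercube d) :
    𝔼 z, f z * f (x * z) = ∑ m ∈ Finset.range (d + 1), levelWeight f m * krawtchouk m x := by
  rw [expect_mul_translate, ← Finset.powerset_univ, Finset.sum_powerset, Finset.card_univ,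
    Fintype.card_fin]
  refine Finset.sum_congr rfl fun m hm => ?_
  have hm' : m ≤ d := Nat.lt_succ_iff.1 (Finset.mem_range.1 hm)
  rw [levelWeight, mul_right_comm, choose_mul_krawtchouk hm', levelSum, Finset.sum_mul]
  refine Finset.sum_congr rfl fun S hS => ?_
  rw [walshCoeff_eq_expect_krawtchouk f hf, (Finset.mem_powersetCard.1 hS).2, mul_comm]

theorem sum_levelWeight {d : ℕ} (f : Hypercube d → ℝ)
    (hf : ∀ (e : Equiv.Perm (Fin d)) x, f (x ∘ e) = f x) :
    ∑ m ∈ Finset.range (d + 1), levelWeight f m = 𝔼 z, f z ^ 2 := by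
  have h := expect_mul_translate_eq_sum_level f hf 1
  have h1 : ∀ m ∈ Finset.range (d + 1), levelWeight f m * krawtchouk m (1 : Hypercube d) =
      levelWeight f m := fun m hm => by
    have hm' : m ≤ d := Nat.lt_succ_iff.1 (Finset.mem_range.1 hm)
    have h0 : (d.choose m : ℝ) ≠ 0 := by exact_mod_cast (Nat.choose_pos hm').ne'
    have : krawtchouk m (1 : Hypercube d) = 1 := by
      rw [krawtchouk, div_eq_one_iff_eq h0]
      simp [levelSum, walsh, coordSign]
    rw [this, mul_one]
  rw [Finset.sum_congr rfl h1] at h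
  rw [← h]
  simp [pow_two]

theorem levelWeight_zero {d : ℕ} (f : Hypercube d → ℝ) : levelWeight f 0 = (𝔼 x, f x) ^ 2 := by
  simp [levelWeight, krawtchouk_zero]

/-! ### Pointwise bounds for Krawtchouk functions -/

/-- Induction on the recurrence. The hypothesis gives `|s| ≤ B d / 4` and `M ≤ B² d / 4` for the
coordinate sum `s`, so each of the two terms costs at most `B ^ (m + 2) d / 4`, while the leading
factor is at least `d / 2`. -/
theorem abs_krawtchouk_le_pow {d M : ℕ} (x : Hypercube d) (hM : 2 * M ≤ d) (hM0 : 1 ≤ M)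
    {B : ℝ} (hB0 : 0 ≤ B) (hB : 16 * (signSum x / d) ^ 2 + 4 * (M / d) ≤ B ^ 2) :
    ∀ m, m ≤ M → |krawtchouk m x| ≤ B ^ m := by
  have hd : (0 : ℝ) < d := by exact_mod_cast (by omega : 0 < d)
  have hMd : (0 : ℝ) ≤ M / d := by positivity
  have hρ : |signSum x| / d ≤ B / 4 := by
    have h1 : (4 * (|signSum x| / d)) ^ 2 ≤ B ^ 2 := by
      have : (|signSum x| / d) ^ 2 = (signSum x / d) ^ 2 := by rw [div_pow, sq_abs, div_pow]
      nlinarith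
    have := (le_abs_self _).trans (abs_le_of_sq_le_sq h1 hB0)
    linarith
  have step : ∀ m, m + 1 ≤ M → |krawtchouk m x| ≤ B ^ m ∧ |krawtchouk (m + 1) x| ≤ B ^ (m + 1) := by
    intro m
    induction m with
    | zero =>
      intro _
      refine ⟨by simp [krawtchouk_zero], ?_⟩
      rw [zero_add, pow_one, krawtchouk_one, abs_div, Nat.abs_cast]
      linarith
    | succ m ih =>
      intro hm
      obtain ⟨h1, h2⟩ := ih (by omega)
      refine ⟨h2, ?_⟩
      have hrec := krawtchouk_recurrence x (by omega : m + 2 ≤ d)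
      have hmM : (m : ℝ) + 2 ≤ M := by exact_mod_cast hm
      have hMd2 : 2 * (M : ℝ) ≤ d := by exact_mod_cast hM
      have hpos : (0 : ℝ) < d - (m + 1) := by linarith
      have hBm : 0 ≤ B ^ m := pow_nonneg hB0 m
      have h3 : ((d : ℝ) - (m + 1)) * |krawtchouk (m + 2) x| ≤
          |signSum x| * B ^ (m + 1) + (m + 1) * B ^ m := by
        rw [← abs_of_pos hpos, ← abs_mul, hrec]
        refine (abs_sub _ _).trans ?_
        rw [abs_mul, abs_mul, abs_of_nonneg (by positivity : (0 : ℝ) ≤ (m : ℝ) + 1)]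
        gcongr
      have hs : |signSum x| ≤ B / 4 * d := by rwa [div_le_iff₀ hd] at hρ
      have hMB : 4 * (M : ℝ) ≤ B ^ 2 * d := by
        have : 4 * ((M : ℝ) / d) ≤ B ^ 2 := by nlinarith [sq_nonneg (signSum x / d)]
        rwa [← mul_div_assoc, div_le_iff₀ hd] at this
      have h4 : |signSum x| * B ^ (m + 1) + (m + 1) * B ^ m ≤ (d / 2) * B ^ (m + 2) := by
        have e : (d / 2 : ℝ) * B ^ (m + 2) = B ^ m * (d / 2 * B ^ 2) := by ring
        have e' : |signSum x| * B ^ (m + 1) + (m + 1) * B ^ m =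
          B ^ m * (|signSum x| * B + (m + 1)) := by ring
        rw [e, e']
        refine mul_le_mul_of_nonneg_left ?_ hBm
        nlinarith
      have h5 : (d / 2 : ℝ) * |krawtchouk (m + 2) x| ≤ (d / 2) * B ^ (m + 2) := by
        refine le_trans (mul_le_mul_of_nonneg_right ?_ (abs_nonneg _)) (h3.trans h4)
        linarith
      exact le_of_mul_le_mul_left h5 (by positivity)
  intro m hm
  rcases m with _ | m
  · simp [krawtchouk_zero]
  · exact (step m hm).2

/-- Beyond level `M` geometric decay is no longer claimed, but up to `d / 2` the bound on two
consecutive values grows by at most a factor `1 + 2 |s| / d` per step. At most `d / 2` steps cost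
`exp |s|` in total. -/
theorem abs_krawtchouk_le_exp {d M m : ℕ} (x : Hypercube d) (hM0 : 1 ≤ M) (hm : M ≤ m)
    (hmd : 2 * m ≤ d) {B : ℝ} (hB0 : 0 ≤ B) (hB1 : B ≤ 1)
    (hB : 16 * (signSum x / d) ^ 2 + 4 * (M / d) ≤ B ^ 2) :
    |krawtchouk m x| ≤ B ^ (M - 1) * Real.exp (|signSum x|) := by
  have hd : (0 : ℝ) < d := by exact_mod_cast (by omega : 0 < d)
  set q : ℝ := 1 + 2 * (|signSum x| / d) with hq
  have hq1 : 1 ≤ q := by rw [hq]; linarith [div_nonneg (abs_nonneg (signSum x)) hd.le]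
  have hV : 0 ≤ B ^ (M - 1) := pow_nonneg hB0 _
  -- The induction starts from the pair of levels `M - 1`, `M`; the weaker exponent `M - 1` serves
  -- both because `B ≤ 1`.
  have step : ∀ k, 2 * (M + k) ≤ d → |krawtchouk (M - 1 + k) x| ≤ B ^ (M - 1) * q ^ k ∧
      |krawtchouk (M - 1 + k + 1) x| ≤ B ^ (M - 1) * q ^ k := by
    intro k
    induction k with
    | zero =>
      intro hk
      have h := abs_krawtchouk_le_pow x (by omega : 2 * M ≤ d) hM0 hB0 hB
      refine ⟨by simpa using h (M - 1) (by omega), ?_⟩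
      refine (h (M - 1 + 0 + 1) (by omega)).trans ?_
      rw [pow_zero, mul_one]
      exact pow_le_pow_of_le_one hB0 hB1 (by omega)
    | succ k ih =>
      intro hk
      obtain ⟨h1, h2⟩ := ih (by omega)
      have hqk : q ^ k ≤ q ^ (k + 1) := pow_le_pow_right₀ hq1 (by omega)
      refine ⟨h2.trans (mul_le_mul_of_nonneg_left hqk hV), ?_⟩
      have hrec := krawtchouk_recurrence x (by omega : M - 1 + k + 2 ≤ d)
      set t : ℕ := M - 1 + k with ht
      have htd : 2 * ((t : ℝ) + 2) ≤ d := by exact_mod_cast (by omega : 2 * (t + 2) ≤ d)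
      have hpos : (0 : ℝ) < d - (t + 1) := by linarith
      have h3 : ((d : ℝ) - (t + 1)) * |krawtchouk (t + 2) x| ≤
          |signSum x| * (B ^ (M - 1) * q ^ k) + (t + 1) * (B ^ (M - 1) * q ^ k) := by
        rw [← abs_of_pos hpos, ← abs_mul, hrec]
        refine (abs_sub _ _).trans ?_
        rw [abs_mul, abs_mul, abs_of_nonneg (by positivity : (0 : ℝ) ≤ (t : ℝ) + 1)]
        gcongr
      have h4 : |signSum x| + (t + 1) ≤ q * (d - (t + 1)) := by
        have e : |signSum x| = |signSum x| / d * d := by field_simp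
        have hnn : 0 ≤ |signSum x| / d := by positivity
        rw [hq]
        nlinarith
      have hW : 0 ≤ B ^ (M - 1) * q ^ k := by positivity
      refine le_of_mul_le_mul_left ?_ hpos
      change ((d : ℝ) - (t + 1)) * |krawtchouk (t + 2) x| ≤ _
      refine h3.trans ?_
      rw [← add_mul, pow_succ]
      nlinarith
  have h := (step (m - M) (by omega)).2
  rw [show M - 1 + (m - M) + 1 = m by omega] at h
  refine h.trans (mul_le_mul_of_nonneg_left ?_ hV)
  have h1 : q ≤ Real.exp (2 * (|signSum x| / d)) := by
    have := Real.add_one_le_exp (2 * (|signSum x| / d)); linarith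
  calc q ^ (m - M) ≤ Real.exp (2 * (|signSum x| / d)) ^ (m - M) := by gcongr
    _ = Real.exp ((m - M : ℕ) * (2 * (|signSum x| / d))) := by rw [← Real.exp_nat_mul]
    _ ≤ Real.exp |signSum x| := by
        rw [Real.exp_le_exp]
        have h2 : (2 * ((m - M : ℕ) : ℝ)) ≤ d := by exact_mod_cast (by omega : 2 * (m - M) ≤ d)
        have hnn : 0 ≤ |signSum x| / d := by positivity
        calc ((m - M : ℕ) : ℝ) * (2 * (|signSum x| / d)) = 2 * ((m - M : ℕ) : ℝ) * (|signSum x| / d) := by ring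
          _ ≤ d * (|signSum x| / d) := by gcongr
          _ = |signSum x| := by field_simp

/-! ### Exponential moments of the coordinate sum -/

theorem expect_units_int (g : ℤˣ → ℝ) : 𝔼 z, g z = (g 1 + g (-1)) / 2 := by
  rw [Fintype.expect_eq_sum_div_card]
  simp [UnitsInt.univ]

theorem signSum_snoc {d : ℕ} (x : Hypercube d) (z : ℤˣ) :
    signSum (Fin.snoc x z : Hypercube (d + 1)) = signSum x + ((z : ℤ) : ℝ) := by
  simp [signSum, coordSign, Fin.sum_univ_castSucc]

/-- One random sign costs 2 in the denominator: `cosh t ≤ exp (t² / 2)` turns the coefficient of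
`s²` into `(μ + 2) / μ²`, which is at most `1 / (μ - 2)`. -/
theorem exp_sq_add_exp_sq_le (s : ℝ) {μ : ℝ} (hμ : 2 < μ) :
    (Real.exp ((s + 1) ^ 2 / μ) + Real.exp ((s - 1) ^ 2 / μ)) / 2 ≤
      Real.exp (1 / μ) * Real.exp (s ^ 2 / (μ - 2)) := by
  have h0 : 0 < μ := by linarith
  have e1 : (s + 1) ^ 2 / μ = (s ^ 2 + 1) / μ + 2 * s / μ := by ring
  have e2 : (s - 1) ^ 2 / μ = (s ^ 2 + 1) / μ + -(2 * s / μ) := by ring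
  rw [e1, e2, Real.exp_add, Real.exp_add, ← mul_add, mul_div_assoc, ← Real.cosh_eq]
  calc _ ≤ Real.exp ((s ^ 2 + 1) / μ) * Real.exp ((2 * s / μ) ^ 2 / 2) := by
        gcongr; exact Real.cosh_le_exp_half_sq _
    _ = Real.exp ((s ^ 2 + 1) / μ + (2 * s / μ) ^ 2 / 2) := by rw [Real.exp_add]
    _ ≤ Real.exp (1 / μ + s ^ 2 / (μ - 2)) := by
        rw [Real.exp_le_exp]
        have : (s ^ 2 + 1) / μ + (2 * s / μ) ^ 2 / 2 = 1 / μ + s ^ 2 * ((μ + 2) / μ ^ 2) := by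
          field_simp; ring
        rw [this, div_eq_mul_one_div (s ^ 2)]
        have h3 : (μ + 2) / μ ^ 2 ≤ 1 / (μ - 2) := by
          rw [div_le_div_iff₀ (by positivity) (by linarith)]
          nlinarith
        gcongr
    _ = _ := by rw [Real.exp_add]

theorem expect_exp_sq_div_le (d : ℕ) {c : ℝ} (hc : 0 < c) :
    𝔼 x : Hypercube d, Real.exp (signSum x ^ 2 / (c + 2 * d)) ≤ Real.exp (d / c) := by
  induction d with
  | zero => simp [signSum]
  | succ d ih =>
    rw [expect_snoc]
    have h : ∀ x : Hypercube d, 𝔼 z, Real.exp (signSum (Fin.snoc x z : Hypercube (d + 1)) ^ 2 /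
        (c + 2 * ((d + 1 : ℕ) : ℝ))) ≤ Real.exp (1 / c) * Real.exp (signSum x ^ 2 / (c + 2 * d)) := by
      intro x
      rw [expect_units_int]
      simp only [signSum_snoc]
      have hd : (0 : ℝ) ≤ d := Nat.cast_nonneg d
      have := exp_sq_add_exp_sq_le (signSum x)
        (by push_cast; linarith : (2 : ℝ) < c + 2 * ((d + 1 : ℕ) : ℝ))
      have e : c + 2 * ((d + 1 : ℕ) : ℝ) - 2 = c + 2 * d := by push_cast; ring
      rw [e] at this
      simp only [Units.val_one, Int.cast_one, Units.val_neg, Int.cast_neg, ← sub_eq_add_neg]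
      refine this.trans ?_
      gcongr
      push_cast
      linarith
    refine (Finset.expect_le_expect fun x _ => h x).trans ?_
    rw [← Finset.mul_expect]
    refine (mul_le_mul_of_nonneg_left ih (Real.exp_nonneg _)).trans_eq ?_
    rw [← Real.exp_add]
    congr 1
    push_cast
    ring

theorem expect_exp_sq_le_two {d : ℕ} (hd : 0 < d) :
    𝔼 x : Hypercube d, Real.exp (signSum x ^ 2 / d / 4) ≤ 2 := by
  have hd' : (0 : ℝ) < d := by exact_mod_cast hd
  have h := expect_exp_sq_div_le d (c := 2 * d) (by positivity)
  have e1 : (d : ℝ) / (2 * d) = 1 / 2 := by field_simp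
  have e2 : ∀ x : Hypercube d, signSum x ^ 2 / (2 * d + 2 * d) = signSum x ^ 2 / d / 4 := by
    intro x; rw [div_div]; congr 1; ring
  simp_rw [e1, e2] at h
  refine h.trans ?_
  have h1 : Real.exp (1 / 2) ^ 2 ≤ 2 ^ 2 := by
    rw [← Real.exp_nat_mul]
    norm_num
    linarith [Real.exp_one_lt_d9]
  exact (le_abs_self _).trans (abs_le_of_sq_le_sq h1 (by norm_num))

/-- Moments of `x ↦ (∑ xᵢ)² / d` against a function of small mean `p`. -/
theorem expect_mul_pow_le {d : ℕ} (hd : 0 < d) (f : Hypercube d → ℝ) (hf0 : ∀ x, 0 ≤ f x)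
    (hf1 : ∀ x, f x ≤ 1) {p : ℝ} (hp : 𝔼 x, f x = p) (hp0 : 0 < p) (hp1 : p ≤ 1) (j : ℕ) :
    𝔼 x, f x * (16 * (signSum x ^ 2 / d) + 8 * j) ^ j ≤
      3 * p * (64 * ((1 + Real.log (1 / p)) + 2 * j)) ^ j := by
  set L : ℝ := 1 + Real.log (1 / p) with hL
  have hL1 : 1 ≤ L := by
    have := Real.log_nonneg ((one_le_div hp0).2 hp1)
    linarith
  set a : ℝ := 64 * (L + 2 * j) with ha
  have hj : (0 : ℝ) ≤ j := Nat.cast_nonneg j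
  have ha0 : 0 < a := by positivity
  have hpt : ∀ x : Hypercube d, f x * (16 * (signSum x ^ 2 / d) + 8 * j) ^ j ≤
      a ^ j * (f x + p * Real.exp (signSum x ^ 2 / d / 4)) := by
    intro x
    set T : ℝ := signSum x ^ 2 / d with hT
    have hT0 : 0 ≤ T := by positivity
    -- In fact `exp (-L) = p / e`.
    have hE : Real.exp (-L) ≤ p := by
      rw [hL, one_div, Real.log_inv, neg_add, neg_neg, Real.exp_add, Real.exp_log hp0]
      have : Real.exp (-1) ≤ 1 := Real.exp_le_one_iff.2 (by norm_num)
      nlinarith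
    -- Below the cutoff `a` the power is at most `a ^ j`, which against `f` contributes `p a ^ j`.
    -- Above it, `y ≤ exp (y - 1)` gives an excess of at most `exp (T / 4 - L) ≤ p exp (T / 4)`,
    -- whose mean is at most `2 p`. Hence the factor `3 p`; the term `L` in `a` pays for the small
    -- measure `p`.
    have hY : (16 * T + 8 * j) ^ j ≤ a ^ j * (1 + p * Real.exp (T / 4)) ∧
        (a < 16 * T + 8 * j → (16 * T + 8 * j) ^ j ≤ a ^ j * (p * Real.exp (T / 4))) := by
      have h2 : a < 16 * T + 8 * j → (16 * T + 8 * j) ^ j ≤ a ^ j * (p * Real.exp (T / 4)) := by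
        intro hlt
        have e : (16 * T + 8 * j) ^ j = a ^ j * ((16 * T + 8 * j) / a) ^ j := by
          rw [← mul_pow, mul_div_cancel₀ _ ha0.ne']
        rw [e]
        gcongr
        have h3 : (16 * T + 8 * j) / a ≤ Real.exp ((16 * T + 8 * j) / a - 1) := by
          have := Real.add_one_le_exp ((16 * T + 8 * j) / a - 1); linarith
        calc ((16 * T + 8 * j) / a) ^ j ≤ Real.exp ((16 * T + 8 * j) / a - 1) ^ j := by gcongr
          _ = Real.exp (j * ((16 * T + 8 * j) / a - 1)) := by rw [← Real.exp_nat_mul]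
          _ ≤ Real.exp (-L + T / 4) := by
              rw [Real.exp_le_exp]
              have h4 : (j : ℝ) * ((16 * T + 8 * j) / a - 1) = j / a * (16 * T + 8 * j - a) := by
                field_simp
              have h5 : (j : ℝ) / a ≤ 1 / 64 := by
                rw [div_le_div_iff₀ ha0 (by norm_num)]; nlinarith
              rw [h4]
              have : j / a * (16 * T + 8 * j - a) ≤ 1 / 64 * (16 * T + 8 * j - a) :=
                mul_le_mul_of_nonneg_right h5 (by linarith)
              rw [ha] at this ⊢
              linarith
          _ ≤ p * Real.exp (T / 4) := by
              rw [Real.exp_add]; gcongr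
      refine ⟨?_, h2⟩
      rcases le_or_gt (16 * T + 8 * j) a with h | h
      · calc (16 * T + 8 * j) ^ j ≤ a ^ j := by gcongr
          _ ≤ a ^ j * (1 + p * Real.exp (T / 4)) := by
            refine le_mul_of_one_le_right (by positivity) ?_
            have : 0 ≤ p * Real.exp (T / 4) := by positivity
            linarith
      · refine (h2 h).trans ?_
        gcongr
        linarith
    calc f x * (16 * T + 8 * j) ^ j ≤ f x * (a ^ j * (1 + p * Real.exp (T / 4))) :=
          mul_le_mul_of_nonneg_left hY.1 (hf0 x)
      _ = a ^ j * (f x + f x * (p * Real.exp (T / 4))) := by ring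
      _ ≤ a ^ j * (f x + 1 * (p * Real.exp (T / 4))) := by
          gcongr; exact hf1 x
      _ = _ := by ring
  refine (Finset.expect_le_expect fun x _ => hpt x).trans ?_
  rw [← Finset.mul_expect, Finset.expect_add_distrib, ← Finset.mul_expect, hp]
  calc _ ≤ a ^ j * (p + p * 2) := by gcongr; exact expect_exp_sq_le_two hd
    _ = _ := by ring

/-! ### The threshold set: top character and odd levels -/

/-- The double threshold connection as a real function. -/
def thresholdIndicator (d : ℕ) (δ : ℤ) (x : Hypercube d) : ℝ :=
  if δ ≤ |∑ i, (x i : ℤ)| then 1 else 0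

theorem signSum_eq_intCast {d : ℕ} (x : Hypercube d) :
    signSum x = ((∑ i, (x i : ℤ) : ℤ) : ℝ) := by
  simp [signSum, coordSign]

theorem even_sum_units {d : ℕ} (hd : Even d) (x : Hypercube d) : Even (∑ i, (x i : ℤ)) := by
  have h : Even (∑ i, ((x i : ℤ) - 1)) := by
    refine Finset.even_sum _ fun i _ => ?_
    rcases Int.units_eq_one_or (x i) with h | h <;> simp [h]
  have e : ∑ i, ((x i : ℤ) - 1) = ∑ i, (x i : ℤ) - d := by simp
  rw [e] at h
  have hd' : Even (d : ℤ) := by exact_mod_cast hd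
  simpa using h.add hd'

/-- Flipping one coordinate. -/
def flipAt {d : ℕ} (i : Fin d) (x : Hypercube d) : Hypercube d := Function.update x i (-x i)

theorem flipAt_flipAt {d : ℕ} (i : Fin d) (x : Hypercube d) : flipAt i (flipAt i x) = x := by
  simp [flipAt]

theorem expect_flipAt {d : ℕ} (i : Fin d) (g : Hypercube d → ℝ) :
    𝔼 x, g (flipAt i x) = 𝔼 x, g x :=
  Fintype.expect_equiv (Function.Involutive.toPerm _ (flipAt_flipAt i)) _ _ fun _ => rfl

theorem sum_flipAt {d : ℕ} (i : Fin d) (x : Hypercube d) :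
    ∑ j, (flipAt i x j : ℤ) = ∑ j, (x j : ℤ) - 2 * (x i : ℤ) := by
  rw [← Finset.add_sum_erase _ _ (Finset.mem_univ i), ← Finset.add_sum_erase Finset.univ
    (fun j => (x j : ℤ)) (Finset.mem_univ i)]
  have h : ∀ j ∈ Finset.univ.erase i, (flipAt i x j : ℤ) = (x j : ℤ) := fun j hj => by
    simp [flipAt, Finset.ne_of_mem_erase hj]
  rw [Finset.sum_congr rfl h]
  simp [flipAt]
  ring

theorem coordSign_flipAt_self {d : ℕ} (i : Fin d) (x : Hypercube d) :
    coordSign (flipAt i x) i = -coordSign x i := by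
  simp [flipAt, coordSign]

theorem walsh_univ_flipAt {d : ℕ} (i : Fin d) (x : Hypercube d) :
    walsh Finset.univ (flipAt i x) = -walsh Finset.univ x := by
  rw [walsh, walsh, ← Finset.mul_prod_erase _ _ (Finset.mem_univ i), ← Finset.mul_prod_erase
    Finset.univ (coordSign x) (Finset.mem_univ i), coordSign_flipAt_self]
  have h : ∀ j ∈ Finset.univ.erase i, coordSign (flipAt i x) j = coordSign x j := fun j hj => by
    simp [flipAt, coordSign, Finset.ne_of_mem_erase hj]
  rw [Finset.prod_congr rfl h]
  ring

theorem expect_eq_zero_of_flip {d : ℕ} (i : Fin d) (g : Hypercube d → ℝ)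
    (hg : ∀ x, g (flipAt i x) = -g x) : 𝔼 x, g x = 0 := by
  have h := expect_flipAt i g
  simp_rw [hg, Finset.expect_neg_distrib] at h
  linarith

theorem thresholdIndicator_nonneg (d : ℕ) (δ : ℤ) (x : Hypercube d) :
    0 ≤ thresholdIndicator d δ x := by
  unfold thresholdIndicator; split_ifs <;> norm_num

theorem thresholdIndicator_le_one (d : ℕ) (δ : ℤ) (x : Hypercube d) :
    thresholdIndicator d δ x ≤ 1 := by
  unfold thresholdIndicator; split_ifs <;> norm_num

theorem thresholdIndicator_comp (d : ℕ) (δ : ℤ) (e : Equiv.Perm (Fin d)) (x : Hypercube d) :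
    thresholdIndicator d δ (x ∘ e) = thresholdIndicator d δ x := by
  unfold thresholdIndicator
  have : ∑ i, ((x ∘ e) i : ℤ) = ∑ i, (x i : ℤ) := Equiv.sum_comp e fun i => (x i : ℤ)
  rw [this]

theorem thresholdIndicator_neg (d : ℕ) (δ : ℤ) (x : Hypercube d) :
    thresholdIndicator d δ (-x) = thresholdIndicator d δ x := by
  unfold thresholdIndicator
  simp

/-- Pairs `x`, `flipAt i x` lying both in the threshold set cancel in both expectations. Only points
that leave the set under the flip remain; there `xᵢ` agrees with the sign of the sum, so the right
side is exactly the measure of this boundary. -/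
theorem abs_expect_walsh_univ_le_single {d : ℕ} (hd : Even d) {δ : ℤ} (hδ : 1 ≤ δ) (i : Fin d) :
    |𝔼 x, thresholdIndicator d δ x * walsh Finset.univ x| ≤
      𝔼 x, thresholdIndicator d δ x * (((∑ j, (x j : ℤ)).sign : ℤ) : ℝ) * coordSign x i := by
  set f := thresholdIndicator d δ with hf
  set sg : Hypercube d → ℝ := fun x => (((∑ j, (x j : ℤ)).sign : ℤ) : ℝ) with hsg
  have h1 : 𝔼 x, f x * f (flipAt i x) * walsh Finset.univ x = 0 :=
    expect_eq_zero_of_flip i _ fun x => by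
      rw [flipAt_flipAt, walsh_univ_flipAt]; ring
  have h2 : 𝔼 x, f x * f (flipAt i x) * (sg x * coordSign x i) = 0 := by
    refine expect_eq_zero_of_flip i _ fun x => ?_
    rw [flipAt_flipAt, coordSign_flipAt_self]
    -- If both points lie in the set, their sums have the same sign: the sums are even and differ by
    -- 2, so a change of sign would make one of them zero, and `δ ≥ 1` excludes that.
    have h3 : f x * f (flipAt i x) * sg (flipAt i x) = f x * f (flipAt i x) * sg x := by
      by_cases ha : δ ≤ |∑ j, (x j : ℤ)|
      · by_cases hb : δ ≤ |∑ j, (flipAt i x j : ℤ)|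
        · congr 1
          simp only [hsg]
          congr 1
          rw [sum_flipAt] at hb ⊢
          have hev := even_sum_units hd x
          obtain ⟨k, hk⟩ := hev
          rw [hk] at ha hb ⊢
          rcases Int.units_eq_one_or (x i) with h | h <;> rw [h] at hb ⊢ <;>
            simp only [Units.val_one, Units.val_neg] at hb ⊢
          all_goals
            rcases lt_trichotomy k 0 with hk0 | hk0 | hk0
            · rw [Int.sign_eq_neg_one_of_neg (by omega : k + k < 0)]
              rw [abs_of_neg (by omega)] at ha
              refine Int.sign_eq_neg_one_of_neg ?_
              by_contra hcon
              rw [abs_of_nonneg (by omega)] at hb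
              omega
            · subst hk0; simp at ha; omega
            · rw [Int.sign_eq_one_of_pos (by omega : 0 < k + k)]
              refine Int.sign_eq_one_of_pos ?_
              by_contra hcon
              rw [abs_of_nonpos (by omega)] at hb
              omega
        · simp [hf, thresholdIndicator, hb]
      · simp [hf, thresholdIndicator, ha]
    linear_combination (-coordSign x i) * h3
  have e1 : 𝔼 x, f x * walsh Finset.univ x =
      𝔼 x, f x * (1 - f (flipAt i x)) * walsh Finset.univ x := by
    rw [← sub_zero (𝔼 x, f x * walsh Finset.univ x), ← h1, ← Finset.expect_sub_distrib]
    exact Finset.expect_congr rfl fun x _ => by ring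
  have e2 : 𝔼 x, f x * sg x * coordSign x i =
      𝔼 x, f x * (1 - f (flipAt i x)) * (sg x * coordSign x i) := by
    rw [← sub_zero (𝔼 x, f x * sg x * coordSign x i), ← h2, ← Finset.expect_sub_distrib]
    exact Finset.expect_congr rfl fun x _ => by ring
  change _ ≤ 𝔼 x, f x * sg x * coordSign x i
  rw [e1, e2]
  refine (Finset.abs_expect_le _ _).trans (Finset.expect_le_expect fun x _ => ?_)
  rw [abs_mul, abs_walsh, mul_one, abs_of_nonneg (mul_nonneg (thresholdIndicator_nonneg d δ x)
    (sub_nonneg.2 (thresholdIndicator_le_one d δ _)))]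
  by_cases ha : δ ≤ |∑ j, (x j : ℤ)|
  · by_cases hb : δ ≤ |∑ j, (flipAt i x j : ℤ)|
    · simp [hf, thresholdIndicator, hb]
    · have : sg x * coordSign x i = 1 := by
        simp only [hsg, coordSign]
        rw [← Int.cast_mul, ← Int.cast_one]
        congr 1
        rw [sum_flipAt] at hb
        set s := ∑ j, (x j : ℤ) with hs
        rcases Int.units_eq_one_or (x i) with h | h <;> rw [h] at hb ⊢ <;>
          simp only [Units.val_one, Units.val_neg] at hb ⊢
        · rw [Int.sign_eq_one_of_pos, one_mul]
          by_contra hcon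
          rw [abs_of_nonpos (by omega)] at ha hb
          omega
        · rw [Int.sign_eq_neg_one_of_neg]; · rfl
          by_contra hcon
          rw [abs_of_nonneg (by omega)] at ha hb
          omega
      rw [this, mul_one]
  · simp [hf, thresholdIndicator, ha]

/-- Sum over the directions `i`: on the right the signs assemble to `|s|`, while the left gains the
factor `d`. -/
theorem abs_expect_walsh_univ_le {d : ℕ} (hd : Even d) {δ : ℤ} (hδ : 1 ≤ δ) :
    d * |𝔼 x, thresholdIndicator d δ x * walsh Finset.univ x| ≤
      𝔼 x, thresholdIndicator d δ x * |signSum x| := by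
  have h : ∑ _i : Fin d, |𝔼 x, thresholdIndicator d δ x * walsh Finset.univ x| ≤
      ∑ i : Fin d, 𝔼 x, thresholdIndicator d δ x * (((∑ j, (x j : ℤ)).sign : ℤ) : ℝ) *
        coordSign x i :=
    Finset.sum_le_sum fun i _ => abs_expect_walsh_univ_le_single hd hδ i
  rw [Finset.sum_const, Finset.card_univ, Fintype.card_fin, nsmul_eq_mul,
    ← Finset.expect_sum_comm] at h
  refine h.trans_eq (Finset.expect_congr rfl fun x _ => ?_)
  rw [← Finset.mul_sum, mul_assoc]
  congr 1
  change _ * signSum x = _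
  rw [signSum_eq_intCast, ← Int.cast_abs, ← Int.cast_mul, Int.sign_mul_self_eq_abs]

theorem krawtchouk_odd_neg {d m : ℕ} (hm : Odd m) (x : Hypercube d) :
    krawtchouk m (-x) = -krawtchouk m x := by
  have h : levelSum m (-x) = -levelSum m x := by
    rw [levelSum, levelSum, ← Finset.sum_neg_distrib]
    refine Finset.sum_congr rfl fun S hS => ?_
    have : ∀ i, coordSign (-x) i = -coordSign x i := fun i => by simp [coordSign]
    rw [walsh, walsh]
    simp_rw [this]
    rw [Finset.prod_neg, (Finset.mem_powersetCard.1 hS).2, hm.neg_one_pow, neg_one_mul]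
  rw [krawtchouk, h, neg_div, krawtchouk]

theorem levelWeight_odd {d m : ℕ} (hm : Odd m) (δ : ℤ) :
    levelWeight (thresholdIndicator d δ) m = 0 := by
  have h : 𝔼 x, thresholdIndicator d δ x * krawtchouk m x = 0 := by
    have h1 : 𝔼 x : Hypercube d, thresholdIndicator d δ (-x) * krawtchouk m (-x) =
        𝔼 x, thresholdIndicator d δ x * krawtchouk m x :=
      Fintype.expect_equiv (Equiv.neg _) _ _ fun x => rfl
    simp_rw [thresholdIndicator_neg, krawtchouk_odd_neg hm, mul_neg,
      Finset.expect_neg_distrib] at h1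
    linarith
  rw [levelWeight, h]
  simp

/-! ### Estimates for a single level -/

theorem pow_le_factorial_mul (j : ℕ) : (4 * (j : ℝ) ^ 2) ^ j ≤ 8 ^ j * ((2 * j).factorial : ℝ) := by
  have h := Real.pow_div_factorial_le_exp (x := ((2 * j : ℕ) : ℝ)) (by positivity) (2 * j)
  rw [div_le_iff₀ (by positivity)] at h
  have e1 : (4 * (j : ℝ) ^ 2) ^ j = ((2 * j : ℕ) : ℝ) ^ (2 * j) := by
    rw [pow_mul]; push_cast; ring
  have e2 : Real.exp ((2 * j : ℕ) : ℝ) ≤ 8 ^ j := by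
    rw [← Real.exp_one_pow, pow_mul]
    gcongr
    have := Real.exp_one_lt_d9
    have := Real.exp_pos 1
    nlinarith
  rw [e1]
  exact h.trans (by gcongr)

/-- Separates the part governed by `L` from the part governed by `j`; in the latter the factorial
absorbs `(2 j) ^ (2 j)` up to a factor `8 ^ j`. -/
theorem level_coeff_le (L : ℝ) (j : ℕ) :
    (64 * (L + 2 * j)) ^ (2 * j) / ((2 * j).factorial : ℝ) ≤
      (2 ^ 14 * L ^ 2) ^ j / ((2 * j).factorial : ℝ) + (2 ^ 17) ^ j := by
  have hf : (0 : ℝ) < ((2 * j).factorial : ℝ) := by positivity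
  have hj : (0 : ℝ) ≤ j := Nat.cast_nonneg j
  rw [div_le_iff₀ hf, add_mul, div_mul_cancel₀ _ hf.ne']
  calc (64 * (L + 2 * j)) ^ (2 * j) = ((64 * (L + 2 * j)) ^ 2) ^ j := by rw [pow_mul]
    _ ≤ (2 ^ 13 * L ^ 2 + 2 ^ 15 * (j : ℝ) ^ 2) ^ j := by
        gcongr
        nlinarith [sq_nonneg (L - 2 * j)]
    _ ≤ 2 ^ (j - 1) * ((2 ^ 13 * L ^ 2) ^ j + (2 ^ 15 * (j : ℝ) ^ 2) ^ j) :=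
        add_pow_le (by positivity) (by positivity) j
    _ ≤ 2 ^ j * ((2 ^ 13 * L ^ 2) ^ j + (2 ^ 15 * (j : ℝ) ^ 2) ^ j) := by
        gcongr
        · norm_num
        · omega
    _ = (2 ^ 14 * L ^ 2) ^ j + (2 ^ 14) ^ j * (4 * (j : ℝ) ^ 2) ^ j := by
        rw [mul_add, ← mul_pow, ← mul_pow, ← mul_pow]; ring
    _ ≤ (2 ^ 14 * L ^ 2) ^ j + (2 ^ 14) ^ j * (8 ^ j * ((2 * j).factorial : ℝ)) := by
        gcongr; exact pow_le_factorial_mul j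
    _ = _ := by rw [← mul_assoc, ← mul_pow]; norm_num

theorem add_pow_le_two_pow {a b : ℝ} (ha : 0 ≤ a) (hb : 0 ≤ b) (j : ℕ) :
    (a + b) ^ j ≤ (2 * a) ^ j + (2 * b) ^ j := by
  calc (a + b) ^ j ≤ 2 ^ (j - 1) * (a ^ j + b ^ j) := add_pow_le ha hb j
    _ ≤ 2 ^ j * (a ^ j + b ^ j) := by
        gcongr
        · norm_num
        · omega
    _ = _ := by rw [mul_add, mul_pow, mul_pow]

theorem pow_le_mul_pow_pred {a b : ℝ} (ha : 0 ≤ a) (hab : a ≤ b) {j : ℕ} (hj : 1 ≤ j) :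
    a ^ j ≤ a * b ^ (j - 1) := by
  obtain ⟨k, rfl⟩ := Nat.exists_eq_add_of_le' hj
  rw [pow_succ', Nat.add_sub_cancel]
  gcongr

theorem quarter_pow_le {j : ℕ} (hj : 1 ≤ j) : ((1 : ℝ) / 4) ^ (j - 1) ≤ 4 * (1 / 2) ^ j := by
  obtain ⟨k, rfl⟩ := Nat.exists_eq_add_of_le' hj
  rw [Nat.add_sub_cancel, pow_succ]
  have : ((1 : ℝ) / 4) ^ k ≤ (1 / 2) ^ k := by gcongr; norm_num
  have : (0 : ℝ) < (1 / 2) ^ k := by positivity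
  linarith

/-- The contribution of level `2 j` in terms of the correlation `u`. -/
theorem level_term_le {L u D : ℝ} (hL : 1 ≤ L) (hu : 0 ≤ u) (hD : 0 < D) {j : ℕ} (hj : 1 ≤ j)
    (hu1 : u ≤ 1 / 2 ^ 12) (hjD : 2 ^ 24 * (j : ℝ) ≤ D) (hLD : 2 ^ 20 * L ^ 2 ≤ D) :
    (64 * (L + 2 * j)) ^ (2 * j) / ((2 * j).factorial : ℝ) * (16 * u ^ 2 + 8 * (j / D)) ^ j ≤
      (1 / 2) ^ j * (2 ^ 25 * L ^ 2 * (u ^ 2 + 1 / D) * Real.exp (2 ^ 10 * u * L)) := by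
  have hL0 : 0 ≤ L := by linarith
  have hj0 : (0 : ℝ) ≤ j := Nat.cast_nonneg j
  have hf : (0 : ℝ) < ((2 * j).factorial : ℝ) := by positivity
  have hexp1 : 1 ≤ Real.exp (2 ^ 10 * u * L) := Real.one_le_exp (by positivity)
  have hL2 : 1 ≤ L ^ 2 := one_le_pow₀ hL
  have hhalf : (0 : ℝ) < (1 / 2) ^ j := by positivity
  -- With `y = 2 ^ 10 u L` the product is `(1 / 2) ^ j y ^ (2 j) / (2 j)!`. One factor `y²` is kept
  -- to give `L² u²`, and the rest is a term of the series of `exp y`.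
  have h1 : (2 ^ 14 * L ^ 2) ^ j / ((2 * j).factorial : ℝ) * (32 * u ^ 2) ^ j ≤
      (1 / 2) ^ j * (2 ^ 20 * L ^ 2 * u ^ 2 * Real.exp (2 ^ 10 * u * L)) := by
    obtain ⟨k, rfl⟩ := Nat.exists_eq_add_of_le' hj
    set y : ℝ := 2 ^ 10 * u * L with hy
    have hy0 : 0 ≤ y := by positivity
    have e : (2 ^ 14 * L ^ 2) ^ (k + 1) / ((2 * (k + 1)).factorial : ℝ) * (32 * u ^ 2) ^ (k + 1) =
        (1 / 2) ^ (k + 1) * (y ^ 2 * (y ^ (2 * k) / ((2 * (k + 1)).factorial : ℝ))) := by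
      rw [div_mul_eq_mul_div, ← mul_pow, ← mul_div_assoc, ← mul_div_assoc, ← pow_add,
        show 2 + 2 * k = 2 * (k + 1) by ring, pow_mul y, ← mul_pow, hy]
      ring
    have h2 : y ^ (2 * k) / ((2 * (k + 1)).factorial : ℝ) ≤ Real.exp y := by
      refine le_trans ?_ (Real.pow_div_factorial_le_exp y hy0 (2 * k))
      gcongr
      omega
    rw [e]
    have e2 : (2 ^ 20 * L ^ 2 * u ^ 2 * Real.exp y : ℝ) = y ^ 2 * Real.exp y := by rw [hy]; ring
    rw [e2]
    gcongr
  -- In this and the next two products one factor of the `j`-th power is kept as the gain `u²` or `1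
  -- / D`; the others are at most `1 / 4` or `1 / 8` by the smallness hypotheses and supply the
  -- decay `(1 / 2) ^ j`.
  have h2 : (2 ^ 14 * L ^ 2) ^ j / ((2 * j).factorial : ℝ) * (16 * (j / D)) ^ j ≤
      (1 / 2) ^ j * (2 ^ 20 * L ^ 2 * (1 / D)) := by
    have hfac : (j : ℝ) ^ j ≤ ((2 * j).factorial : ℝ) := by
      have h3 := Nat.factorial_mul_pow_le_factorial (m := j) (n := j)
      have h4 : j ^ j ≤ (2 * j).factorial := by
        rw [two_mul]
        refine le_trans ?_ h3
        exact le_trans (Nat.pow_le_pow_left (Nat.le_succ j) j)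
          (Nat.le_mul_of_pos_left _ (Nat.factorial_pos j))
      exact_mod_cast h4
    have e : (2 ^ 14 * L ^ 2) ^ j / ((2 * j).factorial : ℝ) * (16 * (j / D)) ^ j =
        (2 ^ 18 * L ^ 2 / D) ^ j * ((j : ℝ) ^ j / ((2 * j).factorial : ℝ)) := by
      rw [div_mul_eq_mul_div, ← mul_pow,
        show 2 ^ 14 * L ^ 2 * (16 * (j / D)) = 2 ^ 18 * L ^ 2 / D * j by ring, mul_pow,
        mul_div_assoc]
    have h3 : 2 ^ 18 * L ^ 2 / D ≤ 1 / 4 := by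
      rw [div_le_iff₀ hD]; linarith
    rw [e]
    calc _ ≤ (2 ^ 18 * L ^ 2 / D) ^ j * 1 := by
          gcongr
          exact div_le_one_of_le₀ hfac hf.le
      _ ≤ 2 ^ 18 * L ^ 2 / D * (1 / 4) ^ (j - 1) := by
          rw [mul_one]; exact pow_le_mul_pow_pred (by positivity) h3 hj
      _ ≤ 2 ^ 18 * L ^ 2 / D * (4 * (1 / 2) ^ j) := by
          gcongr; exact quarter_pow_le hj
      _ = _ := by ring
  have h3 : (2 ^ 17) ^ j * (32 * u ^ 2) ^ j ≤ (1 / 2) ^ j * (2 ^ 24 * u ^ 2) := by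
    have h4 : 2 ^ 22 * u ^ 2 ≤ 1 / 4 := by
      have : u ^ 2 ≤ (1 / 2 ^ 12) ^ 2 := by gcongr
      norm_num at this ⊢
      linarith
    calc (2 ^ 17) ^ j * (32 * u ^ 2) ^ j = (2 ^ 22 * u ^ 2) ^ j := by rw [← mul_pow]; ring
      _ ≤ 2 ^ 22 * u ^ 2 * (1 / 4) ^ (j - 1) := pow_le_mul_pow_pred (by positivity) h4 hj
      _ ≤ 2 ^ 22 * u ^ 2 * (4 * (1 / 2) ^ j) := by gcongr; exact quarter_pow_le hj
      _ = _ := by ring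
  have h4 : (2 ^ 17) ^ j * (16 * (j / D)) ^ j ≤ (1 / 2) ^ j * (2 ^ 24 * (1 / D)) := by
    have h5 : 2 ^ 21 * (j : ℝ) / D ≤ 1 / 8 := by
      rw [div_le_iff₀ hD]; linarith
    have h6 : (j : ℝ) * (1 / 8) ^ (j - 1) ≤ 8 * (1 / 2) ^ j := by
      have h7 : (j : ℝ) ≤ 2 ^ j := by exact_mod_cast Nat.lt_two_pow_self.le
      obtain ⟨k, rfl⟩ := Nat.exists_eq_add_of_le' hj
      rw [Nat.add_sub_cancel]
      calc ((k + 1 : ℕ) : ℝ) * (1 / 8) ^ k ≤ 2 ^ (k + 1) * (1 / 8) ^ k := by gcongr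
        _ = 2 * (1 / 4) ^ k := by
            rw [pow_succ, mul_right_comm, ← mul_pow]; norm_num [mul_comm]
        _ ≤ 2 * (1 / 2) ^ k := by gcongr; norm_num
        _ ≤ 8 * (1 / 2) ^ (k + 1) := by
            rw [pow_succ]
            have : (0 : ℝ) < (1 / 2) ^ k := by positivity
            linarith
    calc (2 ^ 17) ^ j * (16 * (j / D)) ^ j = (2 ^ 21 * j / D) ^ j := by
          rw [← mul_pow]; congr 1; ring
      _ ≤ 2 ^ 21 * j / D * (1 / 8) ^ (j - 1) := pow_le_mul_pow_pred (by positivity) h5 hj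
      _ = 2 ^ 21 / D * (j * (1 / 8) ^ (j - 1)) := by ring
      _ ≤ 2 ^ 21 / D * (8 * (1 / 2) ^ j) := by gcongr
      _ = _ := by ring
  have hA := level_coeff_le L j
  have hR := add_pow_le_two_pow (a := 16 * u ^ 2) (b := 8 * (j / D)) (by positivity)
    (by positivity) j
  rw [show 2 * (16 * u ^ 2) = 32 * u ^ 2 by ring,
    show 2 * (8 * (j / D)) = 16 * (j / D) by ring] at hR
  calc _ ≤ ((2 ^ 14 * L ^ 2) ^ j / ((2 * j).factorial : ℝ) + (2 ^ 17) ^ j) *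
        ((32 * u ^ 2) ^ j + (16 * (j / D)) ^ j) := by gcongr
    _ ≤ (1 / 2) ^ j * (2 ^ 20 * L ^ 2 * u ^ 2 * Real.exp (2 ^ 10 * u * L)) +
        (1 / 2) ^ j * (2 ^ 20 * L ^ 2 * (1 / D)) + (1 / 2) ^ j * (2 ^ 24 * u ^ 2) +
        (1 / 2) ^ j * (2 ^ 24 * (1 / D)) := by
        rw [add_mul, mul_add, mul_add]; linarith
    _ = (1 / 2) ^ j * (2 ^ 20 * (L ^ 2 * u ^ 2 * Real.exp (2 ^ 10 * u * L)) +
        2 ^ 20 * (L ^ 2 * (1 / D)) + 2 ^ 24 * u ^ 2 + 2 ^ 24 * (1 / D)) := by ring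
    _ ≤ _ := by
        refine mul_le_mul_of_nonneg_left ?_ hhalf.le
        set E := Real.exp (2 ^ 10 * u * L)
        have hu2 : 0 ≤ u ^ 2 := sq_nonneg u
        have hD1 : 0 < 1 / D := by positivity
        have a1 : u ^ 2 ≤ L ^ 2 * u ^ 2 * E := by
          rw [mul_right_comm]
          exact le_mul_of_one_le_left hu2 (one_le_mul_of_one_le_of_one_le hL2 hexp1)
        have a2 : 1 / D ≤ L ^ 2 * (1 / D) * E := by
          rw [mul_right_comm]
          exact le_mul_of_one_le_left hD1.le (one_le_mul_of_one_le_of_one_le hL2 hexp1)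
        have a3 : L ^ 2 * (1 / D) ≤ L ^ 2 * (1 / D) * E :=
          le_mul_of_one_le_right (by positivity) hexp1
        have e : 2 ^ 25 * L ^ 2 * (u ^ 2 + 1 / D) * E =
          2 ^ 25 * (L ^ 2 * u ^ 2 * E) + 2 ^ 25 * (L ^ 2 * (1 / D) * E) := by ring
        rw [e]
        have a4 : 0 ≤ L ^ 2 * u ^ 2 * E := by positivity
        have a5 : 0 ≤ L ^ 2 * (1 / D) * E := by positivity
        linarith

/-- `abs_krawtchouk_le_pow` with `M = 2 j` and the optimal `B`, the square root of the base on the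
right. -/
theorem abs_krawtchouk_even_le {d j : ℕ} (hj : 1 ≤ j) (hjd : 4 * j ≤ d) (x : Hypercube d) :
    |krawtchouk (2 * j) x| ≤ (16 * (|signSum x| / d) ^ 2 + 8 * (j / d)) ^ j := by
  set Q : ℝ := 16 * (|signSum x| / d) ^ 2 + 8 * (j / d) with hQ
  have hQ0 : 0 ≤ Q := by positivity
  have h := abs_krawtchouk_le_pow x (by omega : 2 * (2 * j) ≤ d) (by omega) (Real.sqrt_nonneg Q)
    (by
      rw [Real.sq_sqrt hQ0, hQ, div_pow, div_pow, sq_abs]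
      push_cast
      apply le_of_eq
      ring) (2 * j) le_rfl
  rwa [pow_mul, Real.sq_sqrt hQ0] at h

theorem expect_mul_abs_krawtchouk_le {d j : ℕ} (hj : 1 ≤ j) (hjd : 4 * j ≤ d)
    (f : Hypercube d → ℝ) (hf0 : ∀ x, 0 ≤ f x) (hf1 : ∀ x, f x ≤ 1) {p : ℝ}
    (hp : 𝔼 x, f x = p) (hp0 : 0 < p) (hp1 : p ≤ 1) :
    𝔼 x, f x * |krawtchouk (2 * j) x| ≤
      3 * p * (64 * ((1 + Real.log (1 / p)) + 2 * j) / d) ^ j := by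
  have hd : 0 < d := by omega
  have hd' : (0 : ℝ) < d := by exact_mod_cast hd
  have h := expect_mul_pow_le hd f hf0 hf1 hp hp0 hp1 j
  calc 𝔼 x, f x * |krawtchouk (2 * j) x| ≤
      𝔼 x, (f x * (16 * (signSum x ^ 2 / d) + 8 * j) ^ j) / (d : ℝ) ^ j := by
        refine Finset.expect_le_expect fun x _ => ?_
        rw [mul_div_assoc, ← div_pow]
        refine mul_le_mul_of_nonneg_left ((abs_krawtchouk_even_le hj hjd x).trans_eq ?_) (hf0 x)
        congr 1
        rw [div_pow, sq_abs]
        field_simp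
    _ ≤ (3 * p * (64 * ((1 + Real.log (1 / p)) + 2 * j)) ^ j) / (d : ℝ) ^ j := by
        rw [← Finset.expect_div]
        gcongr
    _ = _ := by rw [div_pow, mul_div_assoc]

/-- The factor `d ^ (2 j)` from the binomial coefficient cancels the `d ^ (-2 j)` from the squared
coefficient, so the bound is free of `d`. Mirror levels share both the binomial coefficient and
`|krawtchouk|`. -/
theorem levelWeight_le_of_eq_or_eq {d j : ℕ} (hj : 1 ≤ j) (hjd : 4 * j ≤ d)
    (f : Hypercube d → ℝ) (hf0 : ∀ x, 0 ≤ f x) (hf1 : ∀ x, f x ≤ 1) {p : ℝ}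
    (hp : 𝔼 x, f x = p) (hp0 : 0 < p) (hp1 : p ≤ 1) {m : ℕ} (hm : m = 2 * j ∨ m = d - 2 * j) :
    levelWeight f m ≤ 9 * p ^ 2 *
      ((64 * ((1 + Real.log (1 / p)) + 2 * j)) ^ (2 * j) / ((2 * j).factorial : ℝ)) := by
  have hd' : (0 : ℝ) < d := by exact_mod_cast (by omega : 0 < d)
  set a : ℝ := 64 * ((1 + Real.log (1 / p)) + 2 * j) with ha
  have habs : ∀ x : Hypercube d, |krawtchouk m x| = |krawtchouk (2 * j) x| := by
    intro x
    rcases hm with rfl | rfl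
    · rfl
    · exact abs_krawtchouk_compl (by omega) x
  have hch : d.choose m = d.choose (2 * j) := by
    rcases hm with rfl | rfl
    · rfl
    · exact Nat.choose_symm (by omega)
  have h1 : |𝔼 x, f x * krawtchouk m x| ≤ 3 * p * (a / d) ^ j := by
    refine (Finset.abs_expect_le _ _).trans (le_trans (le_of_eq ?_)
      (expect_mul_abs_krawtchouk_le hj hjd f hf0 hf1 hp hp0 hp1))
    refine Finset.expect_congr rfl fun x _ => ?_
    rw [abs_mul, abs_of_nonneg (hf0 x), habs]
  have h2 : (𝔼 x, f x * krawtchouk m x) ^ 2 ≤ (3 * p * (a / d) ^ j) ^ 2 := by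
    rw [← sq_abs]; gcongr
  have h3 : (d.choose (2 * j) : ℝ) ≤ (d : ℝ) ^ (2 * j) / ((2 * j).factorial : ℝ) :=
    Nat.choose_le_pow_div _ _
  rw [levelWeight, hch]
  calc _ ≤ (d : ℝ) ^ (2 * j) / ((2 * j).factorial : ℝ) * (3 * p * (a / d) ^ j) ^ 2 := by gcongr
    _ = _ := by
        rw [mul_pow, ← pow_mul, mul_comm j 2, div_pow]
        field_simp
        ring

/-- The boundary estimate gives a coefficient of at most `𝔼 f |s| / d`, and the moment bound with `j
= 1` makes the numerator `O(√d p L)`. -/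
theorem levelWeight_top_le {d : ℕ} (hd : Even d) (hd0 : 0 < d) {δ : ℤ} (hδ : 1 ≤ δ) {p : ℝ}
    (hp : 𝔼 x, thresholdIndicator d δ x = p) (hp0 : 0 < p) (hp1 : p ≤ 1) :
    levelWeight (thresholdIndicator d δ) d ≤
      2 ^ 20 * (p ^ 2 * (1 + Real.log (1 / p)) ^ 2 * (1 / d)) := by
  have hd' : (0 : ℝ) < d := by exact_mod_cast hd0
  set L : ℝ := 1 + Real.log (1 / p) with hL
  have hL1 : 1 ≤ L := by
    have := Real.log_nonneg ((one_le_div hp0).2 hp1)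
    linarith
  have h1 := abs_expect_walsh_univ_le hd hδ
  have h2 := expect_mul_pow_le hd0 _ (thresholdIndicator_nonneg d δ)
    (thresholdIndicator_le_one d δ) hp hp0 hp1 1
  have hsd : 0 < √(d : ℝ) := Real.sqrt_pos.2 hd'
  have hss : √(d : ℝ) * √(d : ℝ) = d := Real.mul_self_sqrt hd'.le
  have h3 : 𝔼 x, thresholdIndicator d δ x * |signSum x| ≤ √(d : ℝ) * (576 * p * L) := by
    calc 𝔼 x, thresholdIndicator d δ x * |signSum x| ≤
        𝔼 x, √(d : ℝ) * (thresholdIndicator d δ x *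
          (16 * (signSum x ^ 2 / d) + 8 * ((1 : ℕ) : ℝ)) ^ 1) := by
          refine Finset.expect_le_expect fun x _ => ?_
          rw [mul_left_comm]
          refine mul_le_mul_of_nonneg_left ?_ (thresholdIndicator_nonneg d δ x)
          rw [pow_one, Nat.cast_one, mul_one]
          have e : signSum x ^ 2 / d = (|signSum x| / √(d : ℝ)) ^ 2 := by
            rw [div_pow, sq_abs, Real.sq_sqrt hd'.le]
          rw [e]
          have e2 : |signSum x| = √(d : ℝ) * (|signSum x| / √(d : ℝ)) := by field_simp
          conv_lhs => rw [e2]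
          gcongr
          -- The inequality is `t ≤ 16 t² + 8` for `t = |s| / √d`.
          nlinarith [sq_nonneg (|signSum x| / √(d : ℝ) - 1)]
      _ ≤ √(d : ℝ) * (576 * p * L) := by
          rw [← Finset.mul_expect]
          gcongr
          refine h2.trans ?_
          push_cast
          nlinarith [mul_nonneg hp0.le (sub_nonneg.2 hL1)]
  have hk : ∀ x : Hypercube d, krawtchouk d x = walsh Finset.univ x := by
    intro x
    have := krawtchouk_compl (Nat.zero_le d) x
    rwa [Nat.sub_zero, krawtchouk_zero, mul_one] at this
  rw [levelWeight, Nat.choose_self, Nat.cast_one, one_mul]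
  simp_rw [hk]
  set A : ℝ := 𝔼 x, thresholdIndicator d δ x * walsh Finset.univ x with hA
  have h4 : √(d : ℝ) * |A| ≤ 576 * p * L := by
    have h5 : √(d : ℝ) * (√(d : ℝ) * |A|) ≤ √(d : ℝ) * (576 * p * L) := by
      rw [← mul_assoc, hss]; exact h1.trans h3
    exact le_of_mul_le_mul_left h5 hsd
  have h6 : (√(d : ℝ) * |A|) ^ 2 ≤ (576 * p * L) ^ 2 := by gcongr
  rw [mul_pow, sq_abs, Real.sq_sqrt hd'.le] at h6
  have e : 2 ^ 20 * (p ^ 2 * L ^ 2 * (1 / (d : ℝ))) = (2 ^ 20 * (p ^ 2 * L ^ 2)) / d := by ring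
  rw [e, le_div_iff₀ hd']
  nlinarith [sq_nonneg (p * L)]

/-- Reflection reduces to `2 m ≤ d`. Then `B = 1 / 2` up to level `M = 2 J`, with `J` about `d / 2 ^
24`, gives decay of order `exp (-d / 2 ^ 24)`, and the growth `exp |s| ≤ exp (d / 2 ^ 25)` uses up
only half of the exponent. -/
theorem abs_krawtchouk_mid_le {d m : ℕ} (hd : 2 ^ 24 ≤ d) (hm1 : 2 * (d / 2 ^ 24) < m)
    (hm2 : m + 2 * (d / 2 ^ 24) < d) (x : Hypercube d) (hx : |signSum x| / d ≤ 1 / 2 ^ 25) :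
    |krawtchouk m x| ≤ 8 * Real.exp (-d / 2 ^ 25) := by
  wlog hmd : 2 * m ≤ d generalizing m
  · have := this (m := d - m) (by omega) (by omega) (by omega)
    rwa [abs_krawtchouk_compl (by omega)] at this
  have hd' : (0 : ℝ) < d := by exact_mod_cast (by omega : 0 < d)
  set J := d / 2 ^ 24 with hJ
  have hJ1 : 1 ≤ J := by omega
  have hJd : J * 2 ^ 24 ≤ d := Nat.div_mul_le_self _ _
  have hJd2 : d < (J + 1) * 2 ^ 24 := by omega
  have hJr : (J : ℝ) / d ≤ 1 / 2 ^ 24 := by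
    rw [div_le_div_iff₀ hd' (by norm_num)]
    rw [one_mul]; exact_mod_cast hJd
  have hJr2 : (d : ℝ) / 2 ^ 24 ≤ J + 1 := by
    rw [div_le_iff₀ (by norm_num)]
    exact_mod_cast hJd2.le
  have hu0 : 0 ≤ |signSum x| / d := by positivity
  have h := abs_krawtchouk_le_exp (M := 2 * J) x (by omega) (by omega) hmd
    (B := 1 / 2) (by norm_num) (by norm_num) (by
      have e : (signSum x / d) ^ 2 = (|signSum x| / d) ^ 2 := by rw [div_pow, div_pow, sq_abs]
      have h1 : (|signSum x| / d) ^ 2 ≤ (1 / 2 ^ 25) ^ 2 := by gcongr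
      rw [e]
      push_cast
      rw [mul_div_assoc]
      norm_num at h1 hJr ⊢
      linarith)
  refine h.trans ?_
  have hhalf : (1 / 2 : ℝ) ≤ Real.exp (-(1 / 2)) := by
    have := Real.add_one_le_exp (-(1 / 2) : ℝ); linarith
  have h2 : (1 / 2 : ℝ) ^ (2 * J - 1) ≤ 8 * Real.exp (-(d / 2 ^ 24)) := by
    have e : (1 / 2 : ℝ) ^ (2 * J - 1) = 8 * (1 / 2) ^ (2 * (J + 1)) := by
      rw [show 2 * (J + 1) = (2 * J - 1) + 3 by omega, pow_add]
      norm_num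
      ring
    rw [e]
    gcongr
    calc (1 / 2 : ℝ) ^ (2 * (J + 1)) ≤ Real.exp (-(1 / 2)) ^ (2 * (J + 1)) := by gcongr
      _ = Real.exp (((2 * (J + 1) : ℕ) : ℝ) * -(1 / 2)) := by rw [← Real.exp_nat_mul]
      _ ≤ _ := by
          rw [Real.exp_le_exp]
          push_cast
          linarith
  have h3 : |signSum x| ≤ d / 2 ^ 25 := by
    rw [div_le_iff₀ hd'] at hx; linarith
  calc _ ≤ 8 * Real.exp (-(d / 2 ^ 24)) * Real.exp (d / 2 ^ 25) := by gcongr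
    _ = _ := by
        rw [mul_assoc, ← Real.exp_add]
        congr 2
        ring

/-! ### Summing the levels -/

theorem half_pow_le_three_quarters_pow (j : ℕ) : ((1 : ℝ) / 2) ^ j ≤ (3 / 4) ^ (2 * j) := by
  rw [pow_mul]
  gcongr
  norm_num

/-- The contribution of one level to the autocorrelation of the double threshold. -/
theorem levelWeight_mul_abs_krawtchouk_le {d : ℕ} (hd : Even d) (hd24 : 2 ^ 24 ≤ d) {δ : ℤ}
    (hδ : 1 ≤ δ) {p : ℝ} (hp : 𝔼 x, thresholdIndicator d δ x = p) (hp0 : 0 < p) (hp1 : p ≤ 1)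
    (hL : 2 ^ 20 * (1 + Real.log (1 / p)) ^ 2 ≤ d) (x : Hypercube d)
    (hx : |signSum x| / d ≤ 1 / 2 ^ 25) {m : ℕ} (hm0 : 1 ≤ m) (hmd : m ≤ d) :
    levelWeight (thresholdIndicator d δ) m * |krawtchouk m x| ≤
      9 * p ^ 2 * (2 ^ 25 * (1 + Real.log (1 / p)) ^ 2 * ((|signSum x| / d) ^ 2 + 1 / d) *
        Real.exp (2 ^ 10 * (|signSum x| / d) * (1 + Real.log (1 / p)))) *
          ((3 / 4) ^ m + (3 / 4) ^ (d - m)) +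
      (if m = d then 2 ^ 20 * (p ^ 2 * (1 + Real.log (1 / p)) ^ 2 * (1 / d)) else 0) +
      levelWeight (thresholdIndicator d δ) m * (8 * Real.exp (-d / 2 ^ 25)) := by
  have hd' : (0 : ℝ) < d := by exact_mod_cast (by omega : 0 < d)
  set f := thresholdIndicator d δ with hf
  set L : ℝ := 1 + Real.log (1 / p) with hLdef
  have hL1 : 1 ≤ L := by
    have := Real.log_nonneg ((one_le_div hp0).2 hp1)
    linarith
  set u : ℝ := |signSum x| / d with hu
  have hu0 : 0 ≤ u := by positivity
  set W : ℝ := 2 ^ 25 * L ^ 2 * (u ^ 2 + 1 / d) * Real.exp (2 ^ 10 * u * L) with hW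
  have hW0 : 0 ≤ W := by positivity
  have hw0 : 0 ≤ levelWeight f m := levelWeight_nonneg f m
  have hB0 : (0 : ℝ) ≤ if m = d then 2 ^ 20 * (p ^ 2 * L ^ 2 * (1 / d)) else 0 := by
    split_ifs <;> positivity
  have hC0 : 0 ≤ levelWeight f m * (8 * Real.exp (-d / 2 ^ 25)) := by positivity
  have ha : (0 : ℝ) ≤ (3 / 4) ^ m := by positivity
  have hb : (0 : ℝ) ≤ (3 / 4) ^ (d - m) := by positivity
  -- Covers a level close to `0` and its mirror close to `d` at once; the decay is measured by the
  -- distance `2 j` to the nearer end.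
  have low : ∀ j, 1 ≤ j → j ≤ d / 2 ^ 24 → (m = 2 * j ∨ m = d - 2 * j) →
      levelWeight f m * |krawtchouk m x| ≤ 9 * p ^ 2 * W * (3 / 4) ^ (2 * j) := by
    intro j hj1 hj hm
    have h4 : 4 * j ≤ d := by omega
    have hjd : 2 ^ 24 * (j : ℝ) ≤ d := by
      have : 2 ^ 24 * j ≤ d := by omega
      exact_mod_cast this
    have h1 := levelWeight_le_of_eq_or_eq hj1 h4 f (thresholdIndicator_nonneg d δ)
      (thresholdIndicator_le_one d δ) hp hp0 hp1 hm
    have h2 := abs_krawtchouk_even_le hj1 h4 x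
    have hk : |krawtchouk m x| = |krawtchouk (2 * j) x| := by
      rcases hm with rfl | rfl
      · rfl
      · exact abs_krawtchouk_compl (by omega) x
    have h3 := level_term_le hL1 hu0 hd' hj1
      (hx.trans (by norm_num)) hjd hL
    rw [hk]
    calc levelWeight f m * |krawtchouk (2 * j) x| ≤
        (9 * p ^ 2 * ((64 * (L + 2 * j)) ^ (2 * j) / ((2 * j).factorial : ℝ))) *
          (16 * u ^ 2 + 8 * (j / d)) ^ j := by gcongr
      _ = 9 * p ^ 2 * ((64 * (L + 2 * j)) ^ (2 * j) / ((2 * j).factorial : ℝ) *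
          (16 * u ^ 2 + 8 * (j / d)) ^ j) := by ring
      _ ≤ 9 * p ^ 2 * ((1 / 2) ^ j * W) := by gcongr
      _ ≤ 9 * p ^ 2 * ((3 / 4) ^ (2 * j) * W) := by
          gcongr; exact half_pow_le_three_quarters_pow j
      _ = _ := by ring
  have hP : 0 ≤ 9 * p ^ 2 * W := by positivity
  rcases Nat.even_or_odd m with hm | hm
  · obtain ⟨j, hj⟩ := hm
    obtain ⟨e, he⟩ := hd
    have hj2 : m = 2 * j := by omega
    by_cases h1 : j ≤ d / 2 ^ 24
    · have := low j (by omega) h1 (Or.inl hj2)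
      rw [← hj2] at this
      rw [mul_add]
      linarith [mul_nonneg hP hb]
    · by_cases h2 : m = d
      · have h3 := levelWeight_top_le ⟨e, he⟩ (by omega) hδ hp hp0 hp1
        rw [if_pos h2]
        have h4 : levelWeight f m * |krawtchouk m x| ≤ levelWeight f m :=
          mul_le_of_le_one_right hw0 (abs_krawtchouk_le_one x)
        have h5 : levelWeight f m ≤ 2 ^ 20 * (p ^ 2 * L ^ 2 * (1 / d)) := by rw [h2]; exact h3
        have := mul_nonneg hP (add_nonneg ha hb)
        linarith
      · by_cases h3 : e - j ≤ d / 2 ^ 24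
        · have := low (e - j) (by omega) h3 (Or.inr (by omega))
          rw [show 2 * (e - j) = d - m by omega] at this
          rw [mul_add]
          linarith [mul_nonneg hP ha]
        · have h4 := abs_krawtchouk_mid_le hd24 (m := m) (by omega) (by omega) x hx
          have h5 := mul_le_mul_of_nonneg_left h4 hw0
          have := mul_nonneg hP (add_nonneg ha hb)
          linarith
  · rw [hf, levelWeight_odd hm] at *
    rw [zero_mul, zero_mul]
    have := mul_nonneg hP (add_nonneg ha hb)
    linarith

theorem sum_three_quarters_pow_le (d : ℕ) :
    ∑ m ∈ Finset.range (d + 1), ((3 : ℝ) / 4) ^ m ≤ 4 := by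
  rw [geom_sum_eq (by norm_num)]
  have : (0 : ℝ) ≤ (3 / 4) ^ (d + 1) := by positivity
  rw [div_le_iff_of_neg (by norm_num)]
  linarith

theorem expect_sub_mul_sub {d : ℕ} (f : Hypercube d → ℝ) {p : ℝ} (hp : 𝔼 x, f x = p)
    (x : Hypercube d) :
    𝔼 z, (f z - p) * (f (x * z) - p) = 𝔼 z, f z * f (x * z) - p ^ 2 := by
  have h1 : 𝔼 z, f (x * z) = p := by
    rw [← hp]
    exact Fintype.expect_equiv (Equiv.mulLeft x) _ _ fun _ => rfl
  have h2 : ∀ z, (f z - p) * (f (x * z) - p) =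
      f z * f (x * z) - p * f z - p * f (x * z) + p ^ 2 := fun z => by ring
  simp_rw [h2]
  rw [Finset.expect_add_distrib, Finset.expect_sub_distrib, Finset.expect_sub_distrib,
    ← Finset.mul_expect, ← Finset.mul_expect, h1, hp, Fintype.expect_const]
  ring

/-- Pointwise bound for the autocorrelation of the double threshold near the equator. -/
theorem abs_autocorr_threshold_le {d : ℕ} (hd : Even d) (hd24 : 2 ^ 24 ≤ d) {δ : ℤ}
    (hδ : 1 ≤ δ) {p : ℝ} (hp : 𝔼 x, thresholdIndicator d δ x = p) (hp0 : 0 < p) (hp1 : p ≤ 1)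
    (hL : 2 ^ 20 * (1 + Real.log (1 / p)) ^ 2 ≤ d) (hexp : Real.exp (-d / 2 ^ 25) ≤ p / d)
    (x : Hypercube d) (hx : |signSum x| / d ≤ 1 / 2 ^ 25) :
    |𝔼 z, (thresholdIndicator d δ z - p) * (thresholdIndicator d δ (x * z) - p)| ≤
      2 ^ 33 * (p ^ 2 * (1 + Real.log (1 / p)) ^ 2 * ((|signSum x| / d) ^ 2 + 1 / d) *
        Real.exp (2 ^ 10 * (|signSum x| / d) * (1 + Real.log (1 / p)))) := by
  have hd' : (0 : ℝ) < d := by exact_mod_cast (by omega : 0 < d)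
  have hpt := fun m => levelWeight_mul_abs_krawtchouk_le hd hd24 hδ hp hp0 hp1 hL x hx (m := m)
  set f := thresholdIndicator d δ with hf
  set L : ℝ := 1 + Real.log (1 / p) with hLdef
  have hL1 : 1 ≤ L := by
    have := Real.log_nonneg ((one_le_div hp0).2 hp1)
    linarith
  set u : ℝ := |signSum x| / d with hu
  have hu0 : 0 ≤ u := by positivity
  set E : ℝ := Real.exp (2 ^ 10 * u * L) with hE
  have hE1 : 1 ≤ E := Real.one_le_exp (by positivity)
  set W : ℝ := 2 ^ 25 * L ^ 2 * (u ^ 2 + 1 / d) * E with hW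
  set η : ℝ := 8 * Real.exp (-d / 2 ^ 25) with hη
  have hW0 : 0 ≤ W := by positivity
  have hη0 : 0 ≤ η := by positivity
  rw [expect_sub_mul_sub f hp, expect_mul_translate_eq_sum_level f (thresholdIndicator_comp d δ),
    Finset.sum_range_succ', krawtchouk_zero, levelWeight_zero, hp, mul_one, add_sub_cancel_right]
  have hsum34 : ∑ m ∈ Finset.range d, (((3 : ℝ) / 4) ^ (m + 1) + (3 / 4) ^ (d - (m + 1))) ≤ 8 := by
    rw [Finset.sum_add_distrib]
    have h1 := sum_three_quarters_pow_le d
    rw [Finset.sum_range_succ'] at h1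
    have h2 : ∑ m ∈ Finset.range d, ((3 : ℝ) / 4) ^ (d - (m + 1)) ≤ 4 := by
      have h3 := sum_three_quarters_pow_le d
      rw [Finset.sum_range_succ] at h3
      have h4 := Finset.sum_range_reflect (fun m => ((3 : ℝ) / 4) ^ m) d
      have h5 : ∑ m ∈ Finset.range d, ((3 : ℝ) / 4) ^ (d - (m + 1)) =
          ∑ m ∈ Finset.range d, ((3 : ℝ) / 4) ^ (d - 1 - m) :=
        Finset.sum_congr rfl fun m _ => by congr 1; omega
      have : (0 : ℝ) ≤ (3 / 4) ^ d := by positivity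
      linarith
    have : (0 : ℝ) ≤ (3 / 4) ^ 0 := by positivity
    linarith
  -- Parseval, with `f ^ 2 = f`. This total pays for all middle levels together.
  have hsumw : ∑ m ∈ Finset.range d, levelWeight f (m + 1) ≤ p := by
    have h1 := sum_levelWeight f (thresholdIndicator_comp d δ)
    rw [Finset.sum_range_succ'] at h1
    have h2 : 𝔼 z, f z ^ 2 = p := by
      rw [← hp]
      refine Finset.expect_congr rfl fun z _ => ?_
      simp only [hf, thresholdIndicator]
      split_ifs <;> norm_num
    linarith [levelWeight_nonneg f 0]
  have htop : ∑ m ∈ Finset.range d,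
      (if m + 1 = d then 2 ^ 20 * (p ^ 2 * L ^ 2 * (1 / d)) else (0 : ℝ)) ≤
        2 ^ 20 * (p ^ 2 * L ^ 2 * (1 / d)) := by
    have : ∀ m ∈ Finset.range d, (if m + 1 = d then 2 ^ 20 * (p ^ 2 * L ^ 2 * (1 / (d : ℝ))) else (0 : ℝ)) =
        if m = d - 1 then 2 ^ 20 * (p ^ 2 * L ^ 2 * (1 / (d : ℝ))) else 0 := by
      intro m _
      congr 1
      exact propext (by omega)
    rw [Finset.sum_congr rfl this, Finset.sum_ite_eq']
    split_ifs
    · exact le_rfl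
    · positivity
  calc |∑ m ∈ Finset.range d, levelWeight f (m + 1) * krawtchouk (m + 1) x| ≤
      ∑ m ∈ Finset.range d, levelWeight f (m + 1) * |krawtchouk (m + 1) x| := by
        refine (Finset.abs_sum_le_sum_abs _ _).trans_eq (Finset.sum_congr rfl fun m _ => ?_)
        rw [abs_mul, abs_of_nonneg (levelWeight_nonneg f _)]
    _ ≤ ∑ m ∈ Finset.range d, (9 * p ^ 2 * W * ((3 / 4) ^ (m + 1) + (3 / 4) ^ (d - (m + 1))) +
        (if m + 1 = d then 2 ^ 20 * (p ^ 2 * L ^ 2 * (1 / d)) else 0) +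
        levelWeight f (m + 1) * η) :=
        Finset.sum_le_sum fun m hm => hpt (m + 1) (by omega) (by
          have := Finset.mem_range.1 hm; omega)
    _ ≤ 9 * p ^ 2 * W * 8 + 2 ^ 20 * (p ^ 2 * L ^ 2 * (1 / d)) + p * η := by
        rw [Finset.sum_add_distrib, Finset.sum_add_distrib, ← Finset.mul_sum, ← Finset.sum_mul]
        gcongr
    _ ≤ _ := by
        have h1 : p * η ≤ 8 * (p ^ 2 * L ^ 2 * (1 / d) * E) := by
          have h2 : p * η ≤ p * (8 * (p / d)) := by rw [hη]; gcongr
          have h3 : p * (8 * (p / d)) = 8 * (p ^ 2 * (1 / d)) := by ring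
          have h4 : p ^ 2 * (1 / d) ≤ p ^ 2 * L ^ 2 * (1 / d) * E := by
            have : p ^ 2 * L ^ 2 * (1 / d) * E = p ^ 2 * (1 / d) * (L ^ 2 * E) := by ring
            rw [this]
            exact le_mul_of_one_le_right (by positivity)
              (one_le_mul_of_one_le_of_one_le (one_le_pow₀ hL1) hE1)
          linarith
        have h5 : p ^ 2 * L ^ 2 * (1 / d) ≤ p ^ 2 * L ^ 2 * (1 / d) * E :=
          le_mul_of_one_le_right (by positivity) hE1
        have h6 : 0 ≤ p ^ 2 * L ^ 2 * u ^ 2 * E := by positivity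
        have h7 : 0 ≤ p ^ 2 * L ^ 2 * (1 / d) * E := by positivity
        have e1 : 9 * p ^ 2 * W * 8 = 72 * 2 ^ 25 * (p ^ 2 * L ^ 2 * u ^ 2 * E) +
            72 * 2 ^ 25 * (p ^ 2 * L ^ 2 * (1 / d) * E) := by rw [hW]; ring
        have e2 : 2 ^ 33 * (p ^ 2 * L ^ 2 * (u ^ 2 + 1 / d) * E) =
            2 ^ 33 * (p ^ 2 * L ^ 2 * u ^ 2 * E) + 2 ^ 33 * (p ^ 2 * L ^ 2 * (1 / d) * E) := by ring
        rw [e1, e2]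
        linarith

/-! ### From the autocorrelation to exponential moments -/

theorem expect_autocorr {Γ : Type*} [CommGroup Γ] [Fintype Γ] (σ : Γ → unitInterval) {p : ℝ}
    (hp : 𝔼 z, (σ z : ℝ) = p) : 𝔼 y, autocorr σ p y = 0 := by
  simp only [autocorr]
  rw [Finset.expect_comm]
  have h : ∀ z, 𝔼 y, ((σ z : ℝ) - p) * ((σ (y * z) : ℝ) - p) = 0 := by
    intro z
    have h1 : 𝔼 y, (σ (y * z) : ℝ) = p := by
      rw [← hp]
      exact Fintype.expect_equiv (Equiv.mulRight z) _ _ fun _ => rfl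
    rw [← Finset.mul_expect, Finset.expect_sub_distrib, h1, Fintype.expect_const, sub_self,
      mul_zero]
  simp_rw [h]
  exact Fintype.expect_const 0

/-- By `a b ≤ a² / 2 + b² / 2` and translation invariance the autocorrelation is at most the
variance, and `σ² ≤ σ` bounds that. This crude bound serves away from the equator and keeps `1 + v`
nonnegative. -/
theorem abs_autocorr_le {Γ : Type*} [CommGroup Γ] [Fintype Γ] (σ : Γ → unitInterval) {p : ℝ}
    (hp : 𝔼 z, (σ z : ℝ) = p) (y : Γ) : |autocorr σ p y| ≤ p * (1 - p) := by
  have hvar : 𝔼 z, ((σ z : ℝ) - p) ^ 2 ≤ p * (1 - p) := by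
    have h1 : ∀ z, ((σ z : ℝ) - p) ^ 2 ≤ (σ z : ℝ) - 2 * p * (σ z : ℝ) + p ^ 2 := fun z => by
      have h0 := (σ z).2.1
      have h1 := (σ z).2.2
      nlinarith
    refine (Finset.expect_le_expect fun z _ => h1 z).trans_eq ?_
    rw [Finset.expect_add_distrib, Finset.expect_sub_distrib, ← Finset.mul_expect, hp,
      Fintype.expect_const]
    ring
  have htr : 𝔼 z, ((σ (y * z) : ℝ) - p) ^ 2 = 𝔼 z, ((σ z : ℝ) - p) ^ 2 :=
    Fintype.expect_equiv (Equiv.mulLeft y) _ _ fun _ => rfl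
  calc |autocorr σ p y| ≤ 𝔼 z, |((σ z : ℝ) - p) * ((σ (y * z) : ℝ) - p)| :=
        Finset.abs_expect_le _ _
    _ ≤ 𝔼 z, (((σ z : ℝ) - p) ^ 2 / 2 + ((σ (y * z) : ℝ) - p) ^ 2 / 2) := by
        refine Finset.expect_le_expect fun z _ => ?_
        rw [abs_mul, ← sq_abs ((σ z : ℝ) - p), ← sq_abs ((σ (y * z) : ℝ) - p)]
        nlinarith [sq_nonneg (|(σ z : ℝ) - p| - |(σ (y * z) : ℝ) - p|)]
    _ ≤ p * (1 - p) := by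
        rw [Finset.expect_add_distrib, ← Finset.expect_div, ← Finset.expect_div, htr]
        linarith

theorem exp_le_one_add_add_sq (t : ℝ) : Real.exp t ≤ 1 + t + t ^ 2 * Real.exp |t| := by
  have h1 : |Real.exp t - 1 - t| ≤ t ^ 2 * Real.exp |t| := by
    have h := Complex.norm_exp_sub_sum_le_norm_mul_exp (t : ℂ) 2
    simp only [Finset.sum_range_succ, Finset.sum_range_zero, pow_zero, Nat.factorial, Nat.cast_one,
      div_one, zero_add, pow_one] at h
    simp only [Nat.succ_eq_add_one, zero_add, mul_one, Nat.cast_one, div_one] at h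
    rw [show Complex.exp (t : ℂ) - (1 + (t : ℂ)) = ((Real.exp t - 1 - t : ℝ) : ℂ) by
      push_cast; ring, Complex.norm_real, Complex.norm_real, Real.norm_eq_abs, Real.norm_eq_abs,
      sq_abs] at h
    exact h
  linarith [(abs_le.1 h1).2]

/-- Expand `exp (k v)` to second order: the linear term has mean zero. -/
theorem expect_one_add_pow_le {X : Type*} [Fintype X] [Nonempty X] (v : X → ℝ)
    (hv : 𝔼 x, v x = 0) (hv1 : ∀ x, |v x| ≤ 1) {k n : ℕ} (hk : k ≤ n) :
    𝔼 x, (1 + v x) ^ k ≤ 1 + 𝔼 x, (n * v x) ^ 2 * Real.exp (n * |v x|) := by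
  have hkn : (k : ℝ) ≤ n := by exact_mod_cast hk
  have hpt : ∀ x, (1 + v x) ^ k ≤ 1 + k * v x + (n * v x) ^ 2 * Real.exp (n * |v x|) := by
    intro x
    have h0 : 0 ≤ 1 + v x := by linarith [(abs_le.1 (hv1 x)).1]
    calc (1 + v x) ^ k ≤ Real.exp (v x) ^ k := by
          gcongr; linarith [Real.add_one_le_exp (v x)]
      _ = Real.exp (k * v x) := by rw [← Real.exp_nat_mul]
      _ ≤ 1 + k * v x + (k * v x) ^ 2 * Real.exp |k * v x| := exp_le_one_add_add_sq _
      _ ≤ _ := by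
          rw [abs_mul, Nat.abs_cast, mul_pow, mul_pow]
          gcongr
  refine (Finset.expect_le_expect fun x _ => hpt x).trans_eq ?_
  rw [Finset.expect_add_distrib, Finset.expect_add_distrib, Fintype.expect_const,
    ← Finset.mul_expect, hv]
  ring

/-- Since `p = e · exp (-L)`, the factor `p` beats both `L²` and `exp (L / 4)`. -/
theorem mul_sq_mul_exp_quarter_le {p : ℝ} (hp0 : 0 < p) (hp1 : p ≤ 1) :
    p * (1 + Real.log (1 / p)) ^ 2 * Real.exp ((1 + Real.log (1 / p)) / 4) ≤ 16 := by
  set L : ℝ := 1 + Real.log (1 / p) with hL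
  have hL1 : 1 ≤ L := by
    have := Real.log_nonneg ((one_le_div hp0).2 hp1)
    linarith
  have hp : p = Real.exp 1 * Real.exp (-L) := by
    rw [← Real.exp_add, hL, one_div, Real.log_inv, show 1 + -(1 + -Real.log p) = Real.log p by ring,
      Real.exp_log hp0]
  have h1 := Real.quadratic_le_exp_of_nonneg (x := 3 * L / 4) (by linarith)
  have h2 : L ^ 2 ≤ 4 * Real.exp (3 * L / 4) := by nlinarith
  have he := Real.exp_one_lt_d9
  calc p * L ^ 2 * Real.exp (L / 4) ≤ p * (4 * Real.exp (3 * L / 4)) * Real.exp (L / 4) := by gcongr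
    _ = 4 * Real.exp 1 * (Real.exp (-L) * Real.exp (3 * L / 4) * Real.exp (L / 4)) := by
        rw [hp]; ring
    _ = 4 * Real.exp 1 := by
        rw [← Real.exp_add, ← Real.exp_add]
        rw [show -L + 3 * L / 4 + L / 4 = 0 by ring, Real.exp_zero, mul_one]
    _ ≤ 16 := by linarith

/-- The second-order term of the exponential moment of the normalized autocorrelation. -/
theorem sq_mul_exp_le {d : ℕ} (hd0 : 0 < d) {n p ε : ℝ} (hn : 0 ≤ n) (hp0 : 0 < p) (hp1 : p ≤ 1)
    (hε : 0 < ε) (hL : 2 ^ 40 * (1 + Real.log (1 / p)) ^ 2 ≤ d)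
    (hnd : 2 ^ 53 * n ≤ d) (hnε : 2 ^ 41 * n ≤ ε * d) (x : Hypercube d) {v : ℝ}
    (hv1 : |v| ≤ 1)
    (hv : |signSum x| / d ≤ 1 / 2 ^ 25 →
      |v| ≤ 2 ^ 33 * (p * (1 + Real.log (1 / p)) ^ 2 * ((|signSum x| / d) ^ 2 + 1 / d) *
        Real.exp (2 ^ 10 * (|signSum x| / d) * (1 + Real.log (1 / p)))) / ε) :
    (n * v) ^ 2 * Real.exp (n * |v|) ≤
      (256 * (2 ^ 33 * (n * p * (1 + Real.log (1 / p)) ^ 2) / (ε * d)) ^ 2 +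
        n ^ 2 * Real.exp (-n)) * Real.exp (signSum x ^ 2 / d / 4) := by
  have hd' : (0 : ℝ) < d := by exact_mod_cast hd0
  have hLb := mul_sq_mul_exp_quarter_le hp0 hp1
  set L : ℝ := 1 + Real.log (1 / p) with hLdef
  have hL1 : 1 ≤ L := by
    have := Real.log_nonneg ((one_le_div hp0).2 hp1)
    linarith
  set u : ℝ := |signSum x| / d with hu
  have hu0 : 0 ≤ u := by positivity
  set T : ℝ := signSum x ^ 2 / d with hT
  have hT0 : 0 ≤ T := by positivity
  have hTu : T = d * u ^ 2 := by
    rw [hT, hu, div_pow, sq_abs]; field_simp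
  rw [← sq_abs (n * v), abs_mul, abs_of_nonneg hn]
  rcases le_or_gt u (1 / 2 ^ 25) with h | h
  · have hv' := hv h
    set A : ℝ := 2 ^ 33 * (n * p * L ^ 2) / (ε * d) with hA
    have hA0 : 0 ≤ A := by positivity
    have hud : u ^ 2 + 1 / d = (T + 1) / d := by rw [hTu]; field_simp
    have h1 : n * |v| ≤ A * (T + 1) * Real.exp (2 ^ 10 * u * L) := by
      refine (mul_le_mul_of_nonneg_left hv' hn).trans_eq ?_
      rw [hud, hA]
      field_simp
    -- The allowance is `exp (T / 4)`, up to a constant. It is split as `(T + 1) / 8` for the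
    -- polynomial factor, `(T + 1) / 16` for the exponential inside `v²`, and `(T + 1) / 16` for
    -- `exp (n |v|)`.
    have h2 : A * (T + 1) * Real.exp (2 ^ 10 * u * L) ≤ (T + 1) / 16 := by
      have h3 : Real.exp (2 ^ 10 * u * L) ≤ Real.exp (L / 4) := by
        rw [Real.exp_le_exp]
        have : 2 ^ 10 * u ≤ 1 / 4 := by norm_num at h ⊢; linarith
        nlinarith
      calc A * (T + 1) * Real.exp (2 ^ 10 * u * L) ≤ A * (T + 1) * Real.exp (L / 4) := by gcongr
        _ = (p * L ^ 2 * Real.exp (L / 4)) * (2 ^ 33 * n / (ε * d)) * (T + 1) := by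
            rw [hA]; field_simp
        _ ≤ 16 * (1 / 2 ^ 8) * (T + 1) := by
            have h4 : 2 ^ 33 * n / (ε * d) ≤ 1 / 2 ^ 8 := by
              rw [div_le_div_iff₀ (by positivity) (by norm_num)]
              linarith
            gcongr
        _ = (T + 1) / 16 := by ring
    have h5 : 2 ^ 11 * u * L ≤ (T + 1) / 16 := by
      have h6 : (2 ^ 20 * (u * L)) ^ 2 ≤ (T + 1) ^ 2 := by
        have : (2 ^ 20 * (u * L)) ^ 2 = u ^ 2 * (2 ^ 40 * L ^ 2) := by ring
        rw [this]
        calc u ^ 2 * (2 ^ 40 * L ^ 2) ≤ u ^ 2 * d := by gcongr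
          _ = T := by rw [hTu]; ring
          _ ≤ (T + 1) ^ 2 := by nlinarith
      have h7 := (le_abs_self _).trans (abs_le_of_sq_le_sq h6 (by linarith))
      linarith
    have h8 : (n * |v|) ^ 2 ≤ A ^ 2 * (T + 1) ^ 2 * Real.exp ((T + 1) / 16) := by
      calc (n * |v|) ^ 2 ≤ (A * (T + 1) * Real.exp (2 ^ 10 * u * L)) ^ 2 := by gcongr
        _ = A ^ 2 * (T + 1) ^ 2 * Real.exp (2 ^ 11 * u * L) := by
            rw [mul_pow, mul_pow, ← Real.exp_nat_mul]
            congr 2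
            push_cast; ring
        _ ≤ _ := by gcongr
    have h9 : (T + 1) ^ 2 ≤ 128 * Real.exp ((T + 1) / 8) := by
      have := Real.quadratic_le_exp_of_nonneg (x := (T + 1) / 8) (by linarith)
      nlinarith
    calc (n * |v|) ^ 2 * Real.exp (n * |v|) ≤
        A ^ 2 * (128 * Real.exp ((T + 1) / 8)) * Real.exp ((T + 1) / 16) *
          Real.exp ((T + 1) / 16) := by
          refine mul_le_mul (h8.trans ?_) ?_ (Real.exp_nonneg _) (by positivity)
          · gcongr
          · rw [Real.exp_le_exp]; exact h1.trans h2
      _ = 128 * A ^ 2 * Real.exp (1 / 4) * Real.exp (T / 4) := by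
          rw [mul_assoc _ (Real.exp (1 / 4)), ← Real.exp_add,
            show A ^ 2 * (128 * Real.exp ((T + 1) / 8)) * Real.exp ((T + 1) / 16) *
              Real.exp ((T + 1) / 16) = 128 * A ^ 2 * (Real.exp ((T + 1) / 8) *
              Real.exp ((T + 1) / 16) * Real.exp ((T + 1) / 16)) by ring,
            ← Real.exp_add, ← Real.exp_add]
          congr 2
          ring
      _ ≤ 128 * A ^ 2 * 2 * Real.exp (T / 4) := by
          gcongr
          calc Real.exp (1 / 4) ≤ 1 / (1 - 1 / 4) := by
                have := Real.exp_bound_div_one_sub_of_interval (x := 1 / 4) (by norm_num)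
                  (by norm_num)
                exact this
            _ ≤ 2 := by norm_num
      _ ≤ _ := by
          have : 0 ≤ n ^ 2 * Real.exp (-n) := by positivity
          rw [add_mul]
          have h10 : 0 ≤ n ^ 2 * Real.exp (-n) * Real.exp (T / 4) := by positivity
          linarith
  -- Far from the equator `T = d u² ≥ 8 n`, so the trivial `exp (n |v|) ≤ exp n` is at most `exp (-n
  -- + T / 4)`.
  · have h1 : 8 * n ≤ T := by
      have h2 : (1 / 2 ^ 25) ^ 2 ≤ u ^ 2 := by gcongr
      rw [hTu]
      calc 8 * n = 2 ^ 53 * n * (1 / 2 ^ 25) ^ 2 := by ring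
        _ ≤ d * u ^ 2 := by gcongr
    have h3 : n * |v| ≤ n := mul_le_of_le_one_right hn hv1
    calc (n * |v|) ^ 2 * Real.exp (n * |v|) ≤ n ^ 2 * Real.exp (-n + T / 4) := by
          gcongr
          linarith
      _ = n ^ 2 * Real.exp (-n) * Real.exp (T / 4) := by rw [Real.exp_add, mul_assoc]
      _ ≤ _ := by gcongr; exact le_add_of_nonneg_left (by positivity)

/-! ### The quantitative bound -/

theorem coe_doubleThreshold (d : ℕ) (δ : ℤ) (x : Hypercube d) :
    (doubleThreshold d δ x : ℝ) = thresholdIndicator d δ x := by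
  unfold doubleThreshold thresholdIndicator
  split_ifs <;> simp

theorem doubleThresholdProb_eq (d : ℕ) (δ : ℤ) :
    doubleThresholdProb d δ = 𝔼 x, thresholdIndicator d δ x := by
  rw [doubleThresholdProb, Fintype.expect_eq_sum_div_card, card_hypercube]
  simp [thresholdIndicator]

theorem one_le_of_doubleThresholdProb_lt_one {d : ℕ} {δ : ℤ} (h : doubleThresholdProb d δ < 1) :
    1 ≤ δ := by
  by_contra hδ
  have h1 : ∀ x : Hypercube d, thresholdIndicator d δ x = 1 := fun x => by
    unfold thresholdIndicator
    rw [if_pos]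
    have := abs_nonneg (∑ i, (x i : ℤ))
    omega
  rw [doubleThresholdProb_eq] at h
  simp_rw [h1] at h
  rw [Fintype.expect_const] at h
  exact lt_irrefl _ h

theorem klDiv_randomAlgebraicGraph_eq (n : ℕ) {Γ : Type*} [CommGroup Γ] [Fintype Γ]
    (σ : Γ → unitInterval) (p : unitInterval) (h0 : 0 < (p : ℝ)) (h1 : (p : ℝ) < 1) :
    InformationTheory.klDiv (randomAlgebraicGraph n Γ σ) (SimpleGraph.binomialRandom (Fin n) p) =
      ENNReal.ofReal (relEntropy
        (fun A : SimpleGraph (Fin n) => 𝔼 x : Fin n → Γ, condGraphProb σ x A)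
        (bernoulliGraphProb (p : ℝ))) := by
  refine klDiv_eq_ofReal_relEntropy _ _ _ _
    (fun A => Finset.expect_nonneg fun x _ => condGraphProb_nonneg σ x A)
    (fun A => bernoulliGraphProb_pos h0 h1 A) ?_ (sum_bernoulliGraphProb n p)
    (fun A => randomAlgebraicGraph_singleton n Γ σ A) (fun A => binomialRandom_singleton_eq p A)
  rw [← Finset.expect_sum_comm]
  simp_rw [sum_condGraphProb]
  exact Fintype.expect_const 1

/-- Quantitative form: an explicit bound for the divergence, for large `d`. -/
theorem klDiv_doubleThreshold_le (n : ℕ) {d : ℕ} (hd : Even d) (hd24 : 2 ^ 24 ≤ d) {δ : ℤ}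
    (p : unitInterval) (hp : doubleThresholdProb d δ = p) (hp0 : 0 < (p : ℝ)) {ε : ℝ} (hε : 0 < ε)
    (hpε : (p : ℝ) ≤ 1 - ε) (hL : 2 ^ 40 * (1 + Real.log (1 / (p : ℝ))) ^ 2 ≤ d)
    (hexp : Real.exp (-d / 2 ^ 25) ≤ p / d) (hnd : 2 ^ 53 * (n : ℝ) ≤ d)
    (hnε : 2 ^ 41 * (n : ℝ) ≤ ε * d) :
    InformationTheory.klDiv (randomAlgebraicGraph n (Hypercube d) (doubleThreshold d δ))
        (SimpleGraph.binomialRandom (Fin n) p) ≤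
      ENNReal.ofReal (n * (2 * (256 *
        (2 ^ 33 * (n * (p : ℝ) * (1 + Real.log (1 / (p : ℝ))) ^ 2) / (ε * d)) ^ 2 +
          (n : ℝ) ^ 2 * Real.exp (-n)))) := by
  have hp1 : (p : ℝ) < 1 := by linarith
  have hδ : 1 ≤ δ := one_le_of_doubleThresholdProb_lt_one (d := d) (by rw [hp]; exact hp1)
  have hd0 : 0 < d := by omega
  have hE : 𝔼 x, thresholdIndicator d δ x = (p : ℝ) := by rw [← doubleThresholdProb_eq, hp]
  have hσ : 𝔼 x, (doubleThreshold d δ x : ℝ) = (p : ℝ) := by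
    simp_rw [coe_doubleThreshold]; exact hE
  set P : ℝ := (p : ℝ) with hP
  set Q : ℝ := 256 * (2 ^ 33 * (n * P * (1 + Real.log (1 / P)) ^ 2) / (ε * d)) ^ 2 +
    (n : ℝ) ^ 2 * Real.exp (-n) with hQ
  have hQ0 : 0 ≤ Q := by positivity
  rw [klDiv_randomAlgebraicGraph_eq n _ p hp0 hp1]
  refine ENNReal.ofReal_le_ofReal ((relEntropy_randomAlgebraicGraph_le n _ hp0 hp1).trans ?_)
  have hq : 0 < P * (1 - P) := mul_pos hp0 (by linarith)
  have hqε : P * ε ≤ P * (1 - P) := by gcongr; linarith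
  set v : Hypercube d → ℝ := fun y => autocorr (doubleThreshold d δ) P y / (P * (1 - P)) with hv
  have hv0 : 𝔼 y, v y = 0 := by
    simp only [hv]
    rw [← Finset.expect_div, expect_autocorr _ hσ, zero_div]
  have hv1 : ∀ y, |v y| ≤ 1 := fun y => by
    simp only [hv]
    rw [abs_div, abs_of_pos hq, div_le_one hq]
    exact abs_autocorr_le _ hσ y
  have hv2 : ∀ y : Hypercube d, |signSum y| / d ≤ 1 / 2 ^ 25 →
      |v y| ≤ 2 ^ 33 * (P * (1 + Real.log (1 / P)) ^ 2 * ((|signSum y| / d) ^ 2 + 1 / d) *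
        Real.exp (2 ^ 10 * (|signSum y| / d) * (1 + Real.log (1 / P)))) / ε := by
    intro y hy
    have h1 := abs_autocorr_threshold_le hd hd24 hδ hE hp0 hp1.le (by
      refine le_trans ?_ hL
      gcongr <;> norm_num) hexp y hy
    have h2 : autocorr (doubleThreshold d δ) P y =
        𝔼 z, (thresholdIndicator d δ z - P) * (thresholdIndicator d δ (y * z) - P) := by
      simp only [autocorr, coe_doubleThreshold]
    simp only [hv]
    rw [abs_div, abs_of_pos hq, h2]
    refine (div_le_div₀ (by positivity) h1 (by positivity) hqε).trans_eq ?_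
    field_simp
  have hη : 𝔼 y, ((n : ℝ) * v y) ^ 2 * Real.exp (n * |v y|) ≤ 2 * Q := by
    refine (Finset.expect_le_expect fun y _ => sq_mul_exp_le hd0 (Nat.cast_nonneg n) hp0 hp1.le hε
      hL hnd hnε y (hv1 y) (hv2 y)).trans ?_
    rw [← Finset.mul_expect, mul_comm 2]
    exact mul_le_mul_of_nonneg_left (expect_exp_sq_le_two hd0) hQ0
  have hk : ∀ k ∈ Finset.range n, Real.log (𝔼 y, (1 + v y) ^ k) ≤ 2 * Q := by
    intro k hk
    have h1 := expect_one_add_pow_le v hv0 hv1 (Finset.mem_range.1 hk).le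
    have h2 : 0 ≤ 𝔼 y, (1 + v y) ^ k := Finset.expect_nonneg fun y _ =>
      pow_nonneg (by linarith [(abs_le.1 (hv1 y)).1]) k
    have h3 : Real.log (𝔼 y, (1 + v y) ^ k) ≤ 𝔼 y, (1 + v y) ^ k - 1 := by
      rcases h2.eq_or_lt with h | h
      -- At `0` the convention `log 0 = 0` would break `log t ≤ t - 1`. Bernoulli's inequality and
      -- the zero mean of `v` show that the expectation is at least `1`.
      · exfalso
        have h4 : 1 + k * 𝔼 y, v y ≤ 𝔼 y, (1 + v y) ^ k := by
          have e : 𝔼 y, (1 + k * v y) = 1 + k * 𝔼 y, v y := by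
            rw [Finset.expect_add_distrib, Fintype.expect_const, Finset.mul_expect]
          rw [← e]
          refine Finset.expect_le_expect fun y _ => ?_
          have h5 : -2 ≤ v y := by linarith [(abs_le.1 (hv1 y)).1]
          exact one_add_mul_le_pow h5 k
        rw [hv0] at h4
        linarith
      · exact Real.log_le_sub_one_of_pos h
    linarith
  refine (Finset.sum_le_sum hk).trans_eq ?_
  rw [Finset.sum_const, Finset.card_range, nsmul_eq_mul]

/-! ### Asymptotics -/

theorem eventually_log_sq_le (C : ℝ) :
    ∀ᶠ y : ℝ in atTop, 2 ^ 40 * (1 + C * Real.log y) ^ 2 ≤ y := by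
  have h1 : (fun y : ℝ => (1 + C * Real.log y) ^ 2) =o[atTop] fun y : ℝ => y := by
    have e : (fun y : ℝ => (1 + C * Real.log y) ^ 2) =
        fun y : ℝ => 1 + 2 * C * Real.log y ^ 1 + C ^ 2 * Real.log y ^ 2 := by
      funext y; ring
    rw [e]
    refine ((Asymptotics.isLittleO_const_id_atTop 1).add ?_).add ?_
    · exact (Real.isLittleO_pow_log_id_atTop (n := 1)).const_mul_left _
    · exact (Real.isLittleO_pow_log_id_atTop (n := 2)).const_mul_left _
  filter_upwards [h1.bound (by positivity : (0 : ℝ) < 1 / 2 ^ 40), eventually_ge_atTop 0]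
    with y hy hy0
  rw [Real.norm_of_nonneg (sq_nonneg _), Real.norm_of_nonneg hy0] at hy
  linarith

theorem eventually_exp_neg_le (C : ℝ) :
    ∀ᶠ y : ℝ in atTop, Real.exp (-y / 2 ^ 25) ≤ y ^ (-C) / y := by
  have h := tendsto_rpow_mul_exp_neg_mul_atTop_nhds_zero (C + 1) (1 / 2 ^ 25) (by positivity)
  filter_upwards [h.eventually_le_const one_pos, eventually_gt_atTop 0] with y hy hy0
  have e : y ^ (-C) / y = (y ^ (C + 1))⁻¹ := by
    rw [← Real.rpow_neg hy0.le, neg_add, Real.rpow_add hy0, Real.rpow_neg_one, div_eq_mul_inv]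
  rw [e, ← one_div, le_div_iff₀ (Real.rpow_pos_of_pos hy0 _), mul_comm]
  convert hy using 3
  ring

theorem corollary4p8 :
    ∃ K : ℝ, 0 < K ∧
      ∀ (d : ℕ → ℕ) (p : ℕ → unitInterval) (δ : ℕ → ℤ),
        (∀ᶠ n in atTop, Even (d n)) →
        (∀ᶠ n in atTop, doubleThresholdProb (d n) (δ n) = (p n : ℝ)) →
        (∀ᶠ n : ℕ in atTop, K * ((n : ℝ) * Real.log n) ≤ (d n : ℝ)) →
        ((fun n : ℕ => (n : ℝ) ^ (3 / 2 : ℝ) * (p n : ℝ) * Real.log (1 / (p n : ℝ)) ^ 2)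
          =o[atTop] fun n : ℕ => (d n : ℝ)) →
        (∃ C : ℝ, ∀ᶠ n in atTop, (d n : ℝ) ^ (-C) ≤ (p n : ℝ)) →
        (∃ ε : ℝ, 0 < ε ∧ ∀ᶠ n in atTop, (p n : ℝ) ≤ 1 - ε) →
        Tendsto
          (fun n : ℕ =>
            InformationTheory.klDiv
              (randomAlgebraicGraph n (Hypercube (d n)) (doubleThreshold (d n) (δ n)))
              (SimpleGraph.binomialRandom (Fin n) (p n)))
          atTop (𝓝 0) := by
  -- Any positive `K` would do: only `n = o(d)` is drawn from this hypothesis, as `log n` tends to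
  -- infinity.
  refine ⟨1, one_pos, fun d p δ heven hprob hdn hlittle ⟨C, hC⟩ ⟨ε, hε, hpε⟩ => ?_⟩
  have hlog : Tendsto (fun n : ℕ => Real.log n) atTop atTop :=
    Real.tendsto_log_atTop.comp tendsto_natCast_atTop_atTop
  have hlin : ∀ c : ℝ, ∀ᶠ n : ℕ in atTop, c * (n : ℝ) ≤ d n := by
    intro c
    filter_upwards [hdn, hlog.eventually_ge_atTop c] with n h1 h2
    have hn : (0 : ℝ) ≤ n := Nat.cast_nonneg n
    nlinarith
  have hdtop : Tendsto (fun n : ℕ => (d n : ℝ)) atTop atTop := by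
    refine tendsto_atTop_mono' atTop (hlin 1) ?_
    simpa using (tendsto_natCast_atTop_atTop : Tendsto (fun n : ℕ => (n : ℝ)) atTop atTop)
  have hR := hlittle.tendsto_div_nhds_zero
  set R : ℕ → ℝ := fun n => (n : ℝ) ^ (3 / 2 : ℝ) * (p n : ℝ) * Real.log (1 / (p n : ℝ)) ^ 2 /
    (d n : ℝ) with hRdef
  have hbound : Tendsto (fun n : ℕ => 512 * (2 ^ 33 / ε) ^ 2 * (1 + 1 / ε) ^ 4 * R n ^ 2 +
      2 * ((n : ℝ) ^ 3 * Real.exp (-n))) atTop (𝓝 0) := by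
    have h1 := (hR.pow 2).const_mul (512 * (2 ^ 33 / ε) ^ 2 * (1 + 1 / ε) ^ 4)
    have h2 := ((Real.tendsto_pow_mul_exp_neg_atTop_nhds_zero 3).comp
      (tendsto_natCast_atTop_atTop (R := ℝ))).const_mul 2
    simpa using h1.add h2
  have hbound' := ENNReal.tendsto_ofReal hbound
  rw [ENNReal.ofReal_zero] at hbound'
  refine tendsto_of_tendsto_of_tendsto_of_le_of_le' tendsto_const_nhds hbound'
    (Eventually.of_forall fun _ => zero_le) ?_
  filter_upwards [heven, hprob, hC, hpε, hdtop.eventually (eventually_log_sq_le C),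
    hdtop.eventually (eventually_exp_neg_le C), hdtop.eventually_ge_atTop (2 ^ 24),
    hlin (2 ^ 53), hlin (2 ^ 41 / ε)] with n h1 h2 h3 h4 h5 h6 h7 h8 h9
  have hd' : (0 : ℝ) < d n := lt_of_lt_of_le (by norm_num) h7
  have hp0 : (0 : ℝ) < p n := lt_of_lt_of_le (Real.rpow_pos_of_pos hd' _) h3
  have hℓ : Real.log (1 / (p n : ℝ)) ≤ C * Real.log (d n) := by
    have := Real.log_le_log (Real.rpow_pos_of_pos hd' _) h3
    rw [Real.log_rpow hd'] at this
    rw [one_div, Real.log_inv]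
    linarith
  -- From `log (1 / p) ≥ 1 - p`. Distance of `p` from `1` thus makes `1 + log (1 / p)` comparable to
  -- `log (1 / p)`, the quantity in the hypothesis.
  have hℓε : ε ≤ Real.log (1 / (p n : ℝ)) := by
    rw [one_div, Real.log_inv]
    have := Real.log_le_sub_one_of_pos hp0
    linarith
  have hL : 2 ^ 40 * (1 + Real.log (1 / (p n : ℝ))) ^ 2 ≤ (d n : ℝ) := by
    refine le_trans ?_ h5
    have : 0 ≤ 1 + Real.log (1 / (p n : ℝ)) := by linarith
    gcongr
  have h9' : 2 ^ 41 * (n : ℝ) ≤ ε * d n := by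
    rw [div_mul_eq_mul_div, div_le_iff₀ hε] at h9
    linarith
  refine (klDiv_doubleThreshold_le n h1 (by exact_mod_cast h7) (p n) h2 hp0 hε h4 hL
    (h6.trans (by gcongr)) h8 h9').trans (ENNReal.ofReal_le_ofReal ?_)
  have hn32 : ((n : ℝ) ^ (3 / 2 : ℝ)) ^ 2 = (n : ℝ) ^ 3 := by
    rw [← Real.rpow_natCast, ← Real.rpow_mul (Nat.cast_nonneg n)]
    norm_num
  have hLℓ : 1 + Real.log (1 / (p n : ℝ)) ≤ (1 + 1 / ε) * Real.log (1 / (p n : ℝ)) := by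
    have : 1 ≤ 1 / ε * Real.log (1 / (p n : ℝ)) := by
      rw [div_mul_eq_mul_div, one_mul, one_le_div hε]; exact hℓε
    linarith
  have hL0 : 0 ≤ 1 + Real.log (1 / (p n : ℝ)) := by linarith
  have hL4 : (1 + Real.log (1 / (p n : ℝ))) ^ 4 ≤
      ((1 + 1 / ε) * Real.log (1 / (p n : ℝ))) ^ 4 := by gcongr
  set ℓ : ℝ := Real.log (1 / (p n : ℝ)) with hℓdef
  have e1 : R n ^ 2 = (n : ℝ) ^ 3 * (p n : ℝ) ^ 2 * ℓ ^ 4 / (d n : ℝ) ^ 2 := by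
    rw [hRdef]
    simp only
    rw [div_pow, mul_pow, mul_pow, hn32]
    ring
  have e2 : (n : ℝ) * (2 * (256 * (2 ^ 33 * (n * (p n : ℝ) * (1 + ℓ) ^ 2) / (ε * d n)) ^ 2 +
      (n : ℝ) ^ 2 * Real.exp (-n))) =
      512 * (2 ^ 33 / ε) ^ 2 * ((n : ℝ) ^ 3 * (p n : ℝ) ^ 2 / (d n : ℝ) ^ 2) * (1 + ℓ) ^ 4 +
        2 * ((n : ℝ) ^ 3 * Real.exp (-n)) := by
    field_simp
    ring
  have e3 : 512 * (2 ^ 33 / ε) ^ 2 * (1 + 1 / ε) ^ 4 * R n ^ 2 =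
      512 * (2 ^ 33 / ε) ^ 2 * ((n : ℝ) ^ 3 * (p n : ℝ) ^ 2 / (d n : ℝ) ^ 2) *
        ((1 + 1 / ε) * ℓ) ^ 4 := by
    rw [e1]; ring
  rw [e2, e3]
  gcongr
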